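/- Let $r\ge 1$ and let $a_1,\dots,a_r$ be meromorphic in an open set $\Omega\subseteq\mathbb C$. Consider $$D^rY(z)+a_1(z)D^{r-1}Y(z)+\cdots+a_r(z)Y(z)=0,\qquad D=\frac{d}{dz}.$$ Let $\zeta\in\Omega$ be a regular singular point (some $a_i$ has a pole at $\zeta$, and each $a_i$ has a pole of order at most $i$ there) such that every $a_i$, $i=1,\dots,r$, has a pole of order exactly $1$ at $\zeta$, and suppose that $\delta_1:=\lim_{z\to\zeta}(z-\zeta)a_1(z)$ is real with $\delta_1\ge 0$. Then there is $R>0$ such that the disc of radius $R$ about $\zeta$ lies in $\Omega$ and the following holds for every $0<\rho\le R$, every slit neighborhood $S$ of $\zeta$ obtained by removing one closed radius (including $\zeta$) from the disc $|z-\zeta|<\rho$, and every analytic branch of $\log(z-\zeta)$ on $S$, with $(z-\zeta)^{\alpha}:=\exp(\alpha\log(z-\zeta))$. The complex vector space of all analytic solutions on $S$ has a basis of $r$ functions, of which $r-1$ have the form $$(z-\zeta)^mH_m(z-\zeta),\qquad m=0,1,\dots,r-2,$$ with $H_m$ analytic in $|w|<\rho$ and $H_m(0)\ne 0$. The $r$-th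 basis function is, with some $H$ analytic in $|w|<\rho$ satisfying $H(0)\neq0$, of the following form: 1. if $\delta_1\in\{0,1,\dots,r-1\}$: $$(z-\zeta)^{r-1-\delta_1}H(z-\zeta)\log(z-\zeta)+(z-\zeta)^{r-1}G(z-\zeta),$$ where $G$ is analytic in $|w|<\rho$; 2. if $\delta_1\in\{r,r+1,\dots\}$: $$(z-\zeta)^{r-1-\delta_1}H(z-\zeta)+H_*(z-\zeta)\bigl(\log(z-\zeta)\bigr)^k\quad\text{with }k\in\{0,1\},$$ where $H_*$ is analytic in $|w|<\rho$ and $H_*(z-\zeta)$ is itself a (possibly zero) solution of the equation; 3. if $\delta_1\notin\mathbb Z$: $$(z-\zeta)^{r-1-\delta_1}H(z-\zeta).$$ -/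

import Mathlib

/-- `poleOrder f ζ` is the order of the pole at `ζ` of a function meromorphic at `ζ`; it is `0` when
`f` has at most a removable singularity there (in particular if `f` vanishes near `ζ`). -/
noncomputable def poleOrder (f : ℂ → ℂ) (ζ : ℂ) : ℕ :=
  (-(meromorphicOrderAt f ζ).untop₀).toNat

/-- `ζ` is a regular singular point of
`D^r Y + a_1 D^(r-1) Y + ⋯ + a_r Y = 0` (coefficients meromorphic at `ζ`). -/
def IsRegularSingularPoint (r : ℕ) (a : ℕ → ℂ → ℂ) (ζ : ℂ) : Prop :=
  (∃ i ∈ Finset.Icc 1 r, 0 < poleOrder (a i) ζ) ∧ ∀ i ∈ Finset.Icc 1 r, poleOrder (a i) ζ ≤ i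

/-- The left-hand side `D^r Y + a_1 D^(r-1) Y + ⋯ + a_r Y` at the point `z`. -/
noncomputable def odeOperator (r : ℕ) (a : ℕ → ℂ → ℂ) (Y : ℂ → ℂ) (z : ℂ) : ℂ :=
  iteratedDeriv r Y z + ∑ i ∈ Finset.Icc 1 r, a i z * iteratedDeriv (r - i) Y z

/-- `Y` is an analytic solution of the equation on the set `S`. -/
def IsAnalyticSolutionOn (r : ℕ) (a : ℕ → ℂ → ℂ) (S : Set ℂ) (Y : ℂ → ℂ) : Prop :=
  AnalyticOnNhd ℂ Y S ∧ ∀ z ∈ S, odeOperator r a Y z = 0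

/-- The slit disc: the disc of radius `ρ` about `ζ` without the radius
`{ζ - t e^(iθ) : t ≥ 0}`. -/
def slitDisc (ζ : ℂ) (θ ρ : ℝ) : Set ℂ :=
  {z | z ∈ Metric.ball ζ ρ ∧ (z - ζ) * Complex.exp (-(θ * Complex.I)) ∈ Complex.slitPlane}

/-- The branch of `log w` with imaginary part in `(θ - π, θ + π)`, analytic off the ray
`{-t e^(iθ) : t ≥ 0}`. As `θ` ranges over `ℝ`, all slit directions and all branches occur. -/
noncomputable def logBranch (θ : ℝ) (w : ℂ) : ℂ :=
  Complex.log (w * Complex.exp (-(θ * Complex.I))) + θ * Complex.I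

/-- The corresponding branch `exp (α log w)` of the power `w^α`. -/
noncomputable def powBranch (θ : ℝ) (w α : ℂ) : ℂ :=
  Complex.exp (α * logBranch θ w)

theorem exp_logBranch (θ : ℝ) {w : ℂ} (hw : w ≠ 0) : Complex.exp (logBranch θ w) = w := by
  rw [logBranch, Complex.exp_add, Complex.exp_log (mul_ne_zero hw (Complex.exp_ne_zero _)),
    mul_assoc, ← Complex.exp_add]
  simp

theorem odeOperator_add (r : ℕ) (a : ℕ → ℂ → ℂ) {Y Z : ℂ → ℂ} {z : ℂ}
    (hY : AnalyticAt ℂ Y z) (hZ : AnalyticAt ℂ Z z) :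
    odeOperator r a (Y + Z) z = odeOperator r a Y z + odeOperator r a Z z := by
  have h : ∀ n : ℕ, iteratedDeriv n (Y + Z) z = iteratedDeriv n Y z + iteratedDeriv n Z z :=
    fun n => iteratedDeriv_add hY.contDiffAt hZ.contDiffAt
  simp only [odeOperator, h, mul_add, Finset.sum_add_distrib]
  ring

theorem odeOperator_smul (r : ℕ) (a : ℕ → ℂ → ℂ) {Y : ℂ → ℂ} {z : ℂ}
    (hY : AnalyticAt ℂ Y z) (c : ℂ) :
    odeOperator r a (c • Y) z = c * odeOperator r a Y z := by
  have h : ∀ n : ℕ, iteratedDeriv n (c • Y) z = c * iteratedDeriv n Y z :=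
    fun n => by rw [iteratedDeriv_const_smul hY.contDiffAt c, smul_eq_mul]
  simp only [odeOperator, h, mul_add, Finset.mul_sum]
  congr 1
  exact Finset.sum_congr rfl fun i _ => by ring

/-- The complex vector space of all analytic solutions on `S`, as functions on `S`. -/
def solutionSpace (r : ℕ) (a : ℕ → ℂ → ℂ) (S : Set ℂ) : Submodule ℂ (S → ℂ) where
  carrier := {y | ∃ Y : ℂ → ℂ, IsAnalyticSolutionOn r a S Y ∧ ∀ z : S, y z = Y z}
  add_mem' := by
    rintro y w ⟨Y, hY, hy⟩ ⟨W, hW, hw⟩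
    refine ⟨Y + W, ⟨hY.1.add hW.1, fun z hz => ?_⟩, fun z => by simp [hy, hw]⟩
    rw [odeOperator_add r a (hY.1 z hz) (hW.1 z hz), hY.2 z hz, hW.2 z hz, add_zero]
  zero_mem' := by
    refine ⟨0, ⟨fun z _ => analyticAt_const, fun z _ => ?_⟩, fun z => rfl⟩
    have h := odeOperator_smul r a (Y := 0) (z := z) analyticAt_const 0
    simpa using h
  smul_mem' := by
    rintro c y ⟨Y, hY, hy⟩
    refine ⟨c • Y, ⟨fun z hz => (hY.1 z hz).const_smul, fun z hz => ?_⟩, fun z => by simp [hy]⟩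
    rw [odeOperator_smul r a (hY.1 z hz), hY.2 z hz, mul_zero]

/-! Write r = s + 1 and w = z - ζ. Each a_i has a simple pole, so w^i a_i = ∑ c i k w^k vanishes to
order at least i - 1: c i k = 0 for k + 1 < i. After multiplication by w^r the operator sends w^μ to
∑ P_k(μ) w^(μ+k), where P_k is `frobPoly r c k`. The sparsity of c has two consequences. First,
P_0(x) = x(x-1)⋯(x-s+1)(x-(s-δ)) (`frobPoly_zero`), so the exponents are 0, …, s-1 and s-δ; here δ >
0 because the pole of a_1 is genuine. Second, P_k(m) = 0 for natural numbers m with m + k < s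
(`frobPoly_eval_natCast_eq_zero`).

Try w^l (∑ h_n w^n + log w ∑ p_n w^n). Since w^μ log w is the μ-derivative of w^μ, being a solution
amounts to two triangular systems in P_k and P_k' (`IsFrobeniusPair`), solvable index by index
unless P_0(l+k) = 0. For l = m < s such a resonance has m + k < s, and the second fact kills every
term of the obstruction: no logarithm appears. For l = s-δ with δ not an integer there is no
resonance. For δ = n the first system stays consistent at a resonance by the second fact, together
with p_j = 0 while s-n+j < 0, and the second system is solved for p_k because P_0'(l+k) ≠ 0
(`exists_resonant_coefficients`). Starting from (h_0, p_0) = (0, 1) if n ≤ s and (1, 0) if n > s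
gives the two logarithmic forms. The series converge because P_0(l+k) grows like k^r, which matches
the growth of the other coefficients (`exists_frobenius_coefficients`).

The solutions form a basis: initial values at one point bound the dimension by r
(`IsAnalyticSolutionOn.eqOn_zero`), and along the ray bisecting the slit disc the r solutions have
pairwise different growth (`eq_zero_of_growth`). -/

open Filter Topology Asymptotics

/-! ### Power series with a lower bound on the radius of convergence -/

/-- The power series with coefficients `c` has radius of convergence at least `ρ`. -/
def ConvBound (ρ : ℝ) (c : ℕ → ℂ) : Prop :=
  ∀ x : ℝ, 0 ≤ x → x < ρ → ∃ M : ℝ, ∀ n, ‖c n‖ * x ^ n ≤ M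

/-- The sum of the power series with coefficients `c`. -/
noncomputable def seriesSum (c : ℕ → ℂ) (w : ℂ) : ℂ := ∑' n, c n * w ^ n

theorem seriesSum_zero (c : ℕ → ℂ) : seriesSum c 0 = c 0 := by
  rw [seriesSum, tsum_eq_single 0]
  · simp
  · intro n hn
    simp [hn]

theorem ConvBound.mono {ρ ρ' : ℝ} {c : ℕ → ℂ} (h : ConvBound ρ c) (hρ : ρ' ≤ ρ) :
    ConvBound ρ' c := fun x hx hx' => h x hx (hx'.trans_le hρ)

theorem convBound_of_geometric {c : ℕ → ℂ} {M T : ℝ} (hT : 0 < T) (h : ∀ n, ‖c n‖ ≤ M * T ^ n) :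
    ConvBound T⁻¹ c := by
  intro x hx hxT
  have hM : 0 ≤ M := by simpa using (norm_nonneg _).trans (h 0)
  refine ⟨M, fun n => ?_⟩
  have h1 : T * x ≤ 1 := by
    calc T * x ≤ T * T⁻¹ := by gcongr
      _ = 1 := mul_inv_cancel₀ hT.ne'
  calc ‖c n‖ * x ^ n ≤ M * T ^ n * x ^ n := by gcongr; exact h n
    _ = M * (T * x) ^ n := by rw [mul_pow, mul_assoc]
    _ ≤ M * 1 := by gcongr; exact pow_le_one₀ (by positivity) h1
    _ = M := mul_one M

theorem ConvBound.add {ρ : ℝ} {c d : ℕ → ℂ} (hc : ConvBound ρ c) (hd : ConvBound ρ d) :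
    ConvBound ρ (fun n => c n + d n) := by
  intro x hx hxρ
  obtain ⟨M, hM⟩ := hc x hx hxρ
  obtain ⟨N, hN⟩ := hd x hx hxρ
  refine ⟨M + N, fun n => ?_⟩
  calc ‖c n + d n‖ * x ^ n ≤ (‖c n‖ + ‖d n‖) * x ^ n := by gcongr; exact norm_add_le _ _
    _ = ‖c n‖ * x ^ n + ‖d n‖ * x ^ n := by ring
    _ ≤ M + N := add_le_add (hM n) (hN n)

theorem exists_norm_eval_le (q : Polynomial ℂ) (l : ℂ) (r : ℕ) (hq : q.natDegree ≤ r) :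
    ∃ C : ℝ, 0 ≤ C ∧ ∀ j : ℕ, ‖q.eval (l + j)‖ ≤ C * ((j : ℝ) + 1) ^ r := by
  refine ⟨∑ i ∈ Finset.range (r + 1), ‖q.coeff i‖ * (‖l‖ + 1) ^ i, by positivity, fun j => ?_⟩
  rw [Polynomial.eval_eq_sum_range' (Nat.lt_succ_of_le hq), Finset.sum_mul]
  refine (norm_sum_le _ _).trans (Finset.sum_le_sum fun i hi => ?_)
  have hi : i ≤ r := Nat.lt_succ_iff.mp (Finset.mem_range.mp hi)
  have h1 : ‖l + j‖ ≤ (‖l‖ + 1) * ((j : ℝ) + 1) := by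
    calc ‖l + j‖ ≤ ‖l‖ + j := by simpa using norm_add_le l (j : ℂ)
      _ ≤ (‖l‖ + 1) * ((j : ℝ) + 1) := by
        nlinarith [norm_nonneg l, Nat.cast_nonneg (α := ℝ) j,
          mul_nonneg (norm_nonneg l) (Nat.cast_nonneg (α := ℝ) j)]
  calc ‖q.coeff i * (l + j) ^ i‖ = ‖q.coeff i‖ * ‖l + j‖ ^ i := by rw [norm_mul, norm_pow]
    _ ≤ ‖q.coeff i‖ * ((‖l‖ + 1) * ((j : ℝ) + 1)) ^ i := by gcongr
    _ = ‖q.coeff i‖ * (‖l‖ + 1) ^ i * ((j : ℝ) + 1) ^ i := by rw [mul_pow, mul_assoc]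
    _ ≤ ‖q.coeff i‖ * (‖l‖ + 1) ^ i * ((j : ℝ) + 1) ^ r := by
      gcongr
      linarith [Nat.cast_nonneg (α := ℝ) j]

/-- Polynomial factors do not shrink the radius: passing from x to a slightly larger y gains a
factor (x/y)^n, which absorbs the polynomial growth. -/
theorem ConvBound.eval_mul {ρ : ℝ} {c : ℕ → ℂ} (hc : ConvBound ρ c) (q : Polynomial ℂ) (l : ℂ) :
    ConvBound ρ (fun n => q.eval (l + n) * c n) := by
  intro x hx hxρ
  obtain ⟨y, hxy, hyρ⟩ := exists_between hxρ
  have hy : 0 < y := hx.trans_lt hxy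
  obtain ⟨M, hM⟩ := hc y hy.le hyρ
  obtain ⟨C, hC, hq⟩ := exists_norm_eval_le q l q.natDegree le_rfl
  have hlim : Tendsto (fun n : ℕ => ((n : ℝ) + 1) ^ q.natDegree * (x / y) ^ n) atTop (𝓝 0) := by
    have hk : 0 ≤ x / y := by positivity
    have hk1 : x / y < 1 := (div_lt_one hy).mpr hxy
    have hs : Summable fun n : ℕ => ((n : ℝ) + 1) ^ q.natDegree * (x / y) ^ n := by
      simp_rw [add_pow, one_pow, mul_one, Finset.sum_mul]
      refine summable_sum fun i _ => ?_
      have := (summable_pow_mul_geometric_of_norm_lt_one (R := ℝ) i (r := x / y)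
        (by rwa [Real.norm_of_nonneg hk])).mul_left ((q.natDegree.choose i : ℝ))
      refine this.congr fun n => by ring
    exact hs.tendsto_atTop_zero
  obtain ⟨B, hB⟩ := hlim.bddAbove_range
  have hB' : ∀ n : ℕ, ((n : ℝ) + 1) ^ q.natDegree * (x / y) ^ n ≤ B :=
    fun n => hB (Set.mem_range_self n)
  have hM0 : 0 ≤ M := le_trans (by positivity) (hM 0)
  refine ⟨C * B * M, fun n => ?_⟩
  calc ‖q.eval (l + n) * c n‖ * x ^ n
      = ‖q.eval (l + n)‖ * (x / y) ^ n * (‖c n‖ * y ^ n) := by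
        rw [norm_mul, div_pow]; field_simp
    _ ≤ C * ((n : ℝ) + 1) ^ q.natDegree * (x / y) ^ n * (‖c n‖ * y ^ n) := by
        gcongr; exact hq n
    _ = C * (((n : ℝ) + 1) ^ q.natDegree * (x / y) ^ n) * (‖c n‖ * y ^ n) := by ring
    _ ≤ C * B * M := by
        have := hB' n
        have hB0 : 0 ≤ B := le_trans (by positivity) this
        exact mul_le_mul (by gcongr) (hM n) (by positivity) (by positivity)

theorem ConvBound.summable_pow {ρ : ℝ} {c : ℕ → ℂ} (hc : ConvBound ρ c) {x : ℝ} (hx : 0 ≤ x)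
    (hxρ : x < ρ) : Summable fun n => ‖c n‖ * x ^ n := by
  obtain ⟨y, hxy, hyρ⟩ := exists_between hxρ
  have hy : 0 < y := hx.trans_lt hxy
  obtain ⟨M, hM⟩ := hc y hy.le hyρ
  refine Summable.of_nonneg_of_le (fun n => by positivity) (fun n => ?_)
    ((summable_geometric_of_lt_one (by positivity : 0 ≤ x / y) ((div_lt_one hy).mpr hxy)).mul_left M)
  calc ‖c n‖ * x ^ n = ‖c n‖ * y ^ n * (x / y) ^ n := by rw [div_pow]; field_simp
    _ ≤ M * (x / y) ^ n := by gcongr; exact hM n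

theorem ConvBound.summable_norm {ρ : ℝ} {c : ℕ → ℂ} (hc : ConvBound ρ c) {w : ℂ} (hw : ‖w‖ < ρ) :
    Summable fun n => ‖c n * w ^ n‖ := by
  simpa only [norm_mul, norm_pow] using hc.summable_pow (norm_nonneg w) hw

theorem ConvBound.summable {ρ : ℝ} {c : ℕ → ℂ} (hc : ConvBound ρ c) {w : ℂ} (hw : ‖w‖ < ρ) :
    Summable fun n => c n * w ^ n := (hc.summable_norm hw).of_norm

theorem ConvBound.hasSum {ρ : ℝ} {c : ℕ → ℂ} (hc : ConvBound ρ c) {w : ℂ} (hw : ‖w‖ < ρ) :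
    HasSum (fun n => c n * w ^ n) (seriesSum c w) := (hc.summable hw).hasSum

theorem ConvBound.seriesSum_add {ρ : ℝ} {c d : ℕ → ℂ} (hc : ConvBound ρ c) (hd : ConvBound ρ d)
    {w : ℂ} (hw : ‖w‖ < ρ) :
    seriesSum (fun n => c n + d n) w = seriesSum c w + seriesSum d w := by
  have h := ((hc.hasSum hw).add (hd.hasSum hw)).tsum_eq
  rw [← h, seriesSum]
  exact tsum_congr fun n => add_mul _ _ _

theorem seriesSum_const_mul (a : ℂ) (c : ℕ → ℂ) (w : ℂ) :
    seriesSum (fun n => a * c n) w = a * seriesSum c w := by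
  simp only [seriesSum, mul_assoc, tsum_mul_left]

theorem ConvBound.hasDerivAt {ρ : ℝ} {c : ℕ → ℂ} (hc : ConvBound ρ c) {w : ℂ} (hw : ‖w‖ < ρ) :
    HasDerivAt (seriesSum c) (∑' n, c n * (n * w ^ (n - 1))) w := by
  obtain ⟨x, hwx, hxρ⟩ := exists_between hw
  obtain ⟨y, hxy, hyρ⟩ := exists_between hxρ
  have hx : 0 < x := (norm_nonneg w).trans_lt hwx
  -- Majorant of the differentiated series on the disc of radius x: n x^(n-1) is rewritten as x⁻¹ ·
  -- n x^n.
  have hs : Summable fun n : ℕ => x⁻¹ * (‖(Polynomial.X : Polynomial ℂ).eval (0 + (n : ℂ)) * c n‖ * x ^ n) :=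
    ((hc.eval_mul Polynomial.X 0).summable_pow hx.le hxρ).mul_left _
  refine hasDerivAt_tsum_of_isPreconnected (t := Metric.ball 0 x)
    (g := fun n y => c n * y ^ n) (g' := fun n y => c n * (n * y ^ (n - 1))) hs Metric.isOpen_ball
    (convex_ball _ _).isPreconnected (fun n y _ => (hasDerivAt_pow n y).const_mul (c n)) ?_
    (y₀ := 0) (Metric.mem_ball_self hx) (hc.summable (by simpa using hx.trans hxρ))
    (by simpa using hwx)
  intro n y hy
  have hy' : ‖y‖ ≤ x := by simpa using (Metric.mem_ball.mp hy).le
  rcases n with _ | n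
  · simp
  · have : x⁻¹ * x ^ (n + 1) = x ^ n := by rw [pow_succ']; field_simp
    calc ‖c (n + 1) * (((n + 1 : ℕ) : ℂ) * y ^ (n + 1 - 1))‖
        = ‖((n + 1 : ℕ) : ℂ)‖ * ‖c (n + 1)‖ * ‖y‖ ^ n := by
          rw [norm_mul, norm_mul, norm_pow, Nat.add_sub_cancel]; ring
      _ ≤ ‖((n + 1 : ℕ) : ℂ)‖ * ‖c (n + 1)‖ * x ^ n := by gcongr
      _ = _ := by rw [← this, Polynomial.eval_X, zero_add, norm_mul]; ring

/-- The Euler form of the derivative leaves the index unshifted, so differentiation only multiplies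
coefficients and lowers the exponent in front. -/
theorem ConvBound.hasDerivAt' {ρ : ℝ} {c : ℕ → ℂ} (hc : ConvBound ρ c) {w : ℂ} (hw : ‖w‖ < ρ)
    (hw0 : w ≠ 0) : HasDerivAt (seriesSum c) (w⁻¹ * seriesSum (fun n => n * c n) w) w := by
  convert hc.hasDerivAt hw using 1
  rw [seriesSum, ← tsum_mul_left]
  refine tsum_congr fun n => ?_
  rcases n with _ | n
  · simp
  · rw [Nat.add_sub_cancel, pow_succ]
    field_simp

theorem ConvBound.analyticOnNhd {ρ : ℝ} {c : ℕ → ℂ} (hc : ConvBound ρ c) :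
    AnalyticOnNhd ℂ (seriesSum c) (Metric.ball 0 ρ) := by
  refine DifferentiableOn.analyticOnNhd (fun w hw => ?_) Metric.isOpen_ball
  exact (hc.hasDerivAt (by simpa using hw)).differentiableAt.differentiableWithinAt

theorem ConvBound.hasSum_mul {ρ : ℝ} {c d : ℕ → ℂ} (hc : ConvBound ρ c) (hd : ConvBound ρ d)
    {w : ℂ} (hw : ‖w‖ < ρ) :
    HasSum (fun n => (∑ j ∈ Finset.range (n + 1), c (n - j) * d j) * w ^ n)
      (seriesSum c w * seriesSum d w) := by
  have h1 := hc.summable_norm hw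
  have h2 := hd.summable_norm hw
  have hs := (summable_norm_sum_mul_range_of_summable_norm h2 h1).of_norm
  have ht := tsum_mul_tsum_eq_tsum_sum_range_of_summable_norm h2 h1
  have := hs.hasSum
  rw [← ht, mul_comm] at this
  suffices he : (fun n => (∑ j ∈ Finset.range (n + 1), c (n - j) * d j) * w ^ n) = fun n =>
      ∑ j ∈ Finset.range (n + 1), d j * w ^ j * (c (n - j) * w ^ (n - j)) by
    rw [he]
    exact this
  funext n
  rw [Finset.sum_mul]
  refine Finset.sum_congr rfl fun j hj => ?_
  have hj : n = j + (n - j) := by have := Finset.mem_range.mp hj; omega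
  conv_lhs => rw [hj, pow_add, ← hj]
  ring

theorem ConvBound.shift {ρ : ℝ} {c : ℕ → ℂ} (hc : ConvBound ρ c) (s : ℕ) :
    ConvBound ρ (fun n => c (n + s)) := by
  intro x hx hxρ
  obtain ⟨y, hxy, hyρ⟩ := exists_between hxρ
  have hy : 0 < y := hx.trans_lt hxy
  obtain ⟨M, hM⟩ := hc y hy.le hyρ
  refine ⟨M / y ^ s, fun n => ?_⟩
  rw [le_div_iff₀ (by positivity)]
  calc ‖c (n + s)‖ * x ^ n * y ^ s ≤ ‖c (n + s)‖ * y ^ n * y ^ s := by gcongr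
    _ = ‖c (n + s)‖ * y ^ (n + s) := by rw [pow_add, mul_assoc]
    _ ≤ M := hM _

theorem ConvBound.seriesSum_eq_shift {ρ : ℝ} {c : ℕ → ℂ} (hc : ConvBound ρ c) (s : ℕ)
    (h0 : ∀ n < s, c n = 0) {w : ℂ} (hw : ‖w‖ < ρ) :
    seriesSum c w = w ^ s * seriesSum (fun n => c (n + s)) w := by
  rw [seriesSum, ← (hc.summable hw).sum_add_tsum_nat_add s,
    Finset.sum_eq_zero fun n hn => by rw [h0 n (Finset.mem_range.mp hn), zero_mul], zero_add,
    seriesSum, ← tsum_mul_left]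
  exact tsum_congr fun n => by rw [pow_add]; ring

/-! ### The slit disc and the branches of logarithm and powers -/

theorem isOpen_slitDisc (ζ : ℂ) (θ ρ : ℝ) : IsOpen (slitDisc ζ θ ρ) :=
  Metric.isOpen_ball.inter (Complex.isOpen_slitPlane.preimage (by fun_prop))

theorem norm_sub_lt_of_mem_slitDisc {ζ z : ℂ} {θ ρ : ℝ} (hz : z ∈ slitDisc ζ θ ρ) :
    ‖z - ζ‖ < ρ := by simpa [dist_eq_norm] using hz.1

theorem sub_ne_zero_of_mem_slitDisc {ζ z : ℂ} {θ ρ : ℝ} (hz : z ∈ slitDisc ζ θ ρ) :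
    z - ζ ≠ 0 := by
  intro h
  have := hz.2
  rw [h, zero_mul] at this
  exact Complex.zero_notMem_slitPlane this

/-- The points of the ray bisecting the slit disc. -/
theorem ray_mem_slitDisc (ζ : ℂ) (θ : ℝ) {ρ t : ℝ} (ht : 0 < t) (htρ : t < ρ) :
    ζ + t * Complex.exp (θ * Complex.I) ∈ slitDisc ζ θ ρ := by
  constructor
  · simp [Complex.norm_exp_ofReal_mul_I, abs_of_pos ht, htρ]
  · rw [add_sub_cancel_left, mul_assoc, ← Complex.exp_add]
    simp [ht]

theorem isPreconnected_slitDisc (ζ : ℂ) (θ ρ : ℝ) : IsPreconnected (slitDisc ζ θ ρ) := by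
  rcases le_or_gt ρ 0 with hρ | hρ
  · have : slitDisc ζ θ ρ = ∅ := by
      ext z
      simp [slitDisc, Metric.ball_eq_empty.mpr hρ]
    rw [this]
    exact isPreconnected_empty
  -- Up to a rotation and a translation the slit disc is a disc cut along the negative axis, which
  -- is star-shaped about any positive point inside it.
  have h1 : StarConvex ℝ ((ρ / 2 : ℝ) : ℂ) (Metric.ball (0 : ℂ) ρ ∩ Complex.slitPlane) := by
    refine StarConvex.inter ((convex_ball _ _).starConvex ?_) ?_
    · simp [abs_of_pos hρ, hρ]
    · exact Complex.starConvex_ofReal_slitPlane (by positivity)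
  have hne : ((ρ / 2 : ℝ) : ℂ) ∈ Metric.ball (0 : ℂ) ρ ∩ Complex.slitPlane := by
    refine ⟨by simp [abs_of_pos hρ, hρ], ?_⟩
    rw [Complex.ofReal_mem_slitPlane]
    positivity
  have h2 := (h1.isPathConnected hne).isConnected.isPreconnected
  have h3 : slitDisc ζ θ ρ = (fun w => ζ + w * Complex.exp (θ * Complex.I)) ''
      (Metric.ball (0 : ℂ) ρ ∩ Complex.slitPlane) := by
    ext z
    constructor
    · intro hz
      refine ⟨(z - ζ) * Complex.exp (-(θ * Complex.I)), ⟨?_, hz.2⟩, ?_⟩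
      · have : ‖Complex.exp (-(θ * Complex.I))‖ = 1 := by
          have := Complex.norm_exp_ofReal_mul_I (-θ)
          simpa using this
        simpa [this] using norm_sub_lt_of_mem_slitDisc hz
      · simp only []
        rw [mul_assoc, ← Complex.exp_add]
        simp
    · rintro ⟨w, ⟨hw, hw'⟩, rfl⟩
      refine ⟨?_, ?_⟩
      · simpa [Complex.norm_exp_ofReal_mul_I] using hw
      · rw [add_sub_cancel_left, mul_assoc, ← Complex.exp_add]
        simpa using hw'
  rw [h3]
  exact h2.image _ (by fun_prop)

theorem hasDerivAt_logBranch (θ : ℝ) {w : ℂ}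
    (hw : w * Complex.exp (-(θ * Complex.I)) ∈ Complex.slitPlane) :
    HasDerivAt (logBranch θ) w⁻¹ w := by
  have h := ((hasDerivAt_id w).mul_const (Complex.exp (-(θ * Complex.I)))).clog hw
  have h2 := h.add_const (θ * Complex.I)
  refine h2.congr_deriv ?_
  have := Complex.exp_ne_zero (-(θ * Complex.I))
  simp only [id, one_mul]
  rw [div_mul_eq_div_div_swap, div_self this, one_div]

theorem powBranch_sub_one (θ : ℝ) {w : ℂ} (hw : w ≠ 0) (l : ℂ) :
    powBranch θ w (l - 1) = powBranch θ w l * w⁻¹ := by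
  rw [powBranch, powBranch, sub_mul, one_mul, Complex.exp_sub, exp_logBranch θ hw, div_eq_mul_inv]

theorem powBranch_sub_natCast (θ : ℝ) {w : ℂ} (hw : w ≠ 0) (l : ℂ) (k : ℕ) :
    powBranch θ w (l - k) = powBranch θ w l * (w ^ k)⁻¹ := by
  rw [powBranch, powBranch, sub_mul, Complex.exp_sub, Complex.exp_nat_mul, exp_logBranch θ hw,
    div_eq_mul_inv]

theorem powBranch_natCast (θ : ℝ) {w : ℂ} (hw : w ≠ 0) (k : ℕ) :
    powBranch θ w k = w ^ k := by
  rw [powBranch, Complex.exp_nat_mul, exp_logBranch θ hw]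

theorem hasDerivAt_powBranch (θ : ℝ) (l : ℂ) {w : ℂ} (hw0 : w ≠ 0)
    (hw : w * Complex.exp (-(θ * Complex.I)) ∈ Complex.slitPlane) :
    HasDerivAt (fun w => powBranch θ w l) (l * powBranch θ w (l - 1)) w := by
  have h := ((hasDerivAt_logBranch θ hw).const_mul l).cexp
  refine h.congr_deriv ?_
  rw [powBranch_sub_one θ hw0, powBranch]
  ring

/-! ### Logarithmic Frobenius series and their derivatives -/

/-- The function `w ^ l * (∑ hₙ wⁿ + log w * ∑ pₙ wⁿ)` of `w = z - ζ`. -/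
noncomputable def frobFun (ζ : ℂ) (θ : ℝ) (l : ℂ) (h p : ℕ → ℂ) (z : ℂ) : ℂ :=
  powBranch θ (z - ζ) l * (seriesSum h (z - ζ) + logBranch θ (z - ζ) * seriesSum p (z - ζ))

/-- These functions are closed under differentiation: the exponent drops by one, and the derivative
of log w moves p into the log-free part. -/
theorem hasDerivAt_frobFun {ζ : ℂ} {θ ρ : ℝ} (l : ℂ) {h p : ℕ → ℂ} (hh : ConvBound ρ h)
    (hp : ConvBound ρ p) {z : ℂ} (hz : z ∈ slitDisc ζ θ ρ) :
    HasDerivAt (frobFun ζ θ l h p)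
      (frobFun ζ θ (l - 1) (fun n => (l + n) * h n + p n) (fun n => (l + n) * p n) z) z := by
  have hw := norm_sub_lt_of_mem_slitDisc hz
  have hw0 := sub_ne_zero_of_mem_slitDisc hz
  have h1 := hasDerivAt_powBranch θ l hw0 hz.2
  have h2 := (hh.hasDerivAt' hw hw0).add
    ((hasDerivAt_logBranch θ hz.2).mul (hp.hasDerivAt' hw hw0))
  have h3 := (h1.mul h2).comp_sub_const z ζ
  have e1 : ∀ {c : ℕ → ℂ}, ConvBound ρ c → seriesSum (fun n => (l + n) * c n) (z - ζ)
      = l * seriesSum c (z - ζ) + seriesSum (fun n => n * c n) (z - ζ) := by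
    intro c hc
    have hn : ConvBound ρ (fun n => n * c n) := by simpa using hc.eval_mul Polynomial.X 0
    have hl : ConvBound ρ (fun n => l * c n) := by simpa using hc.eval_mul (Polynomial.C l) 0
    rw [← seriesSum_const_mul, ← hl.seriesSum_add hn hw]
    simp only [add_mul]
  have hl : ConvBound ρ (fun n => (l + n) * h n) := by simpa using hh.eval_mul Polynomial.X l
  refine HasDerivAt.congr_deriv (f := frobFun ζ θ l h p) h3 ?_
  rw [frobFun, hl.seriesSum_add hp hw, e1 hh, e1 hp, powBranch_sub_one θ hw0]
  simp only [Pi.add_apply, Pi.mul_apply]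
  ring

theorem analyticOnNhd_frobFun {ζ : ℂ} {θ ρ : ℝ} (l : ℂ) {h p : ℕ → ℂ} (hh : ConvBound ρ h)
    (hp : ConvBound ρ p) : AnalyticOnNhd ℂ (frobFun ζ θ l h p) (slitDisc ζ θ ρ) :=
  DifferentiableOn.analyticOnNhd (fun _ hz =>
    (hasDerivAt_frobFun l hh hp hz).differentiableAt.differentiableWithinAt) (isOpen_slitDisc ζ θ ρ)

/-- The k-th derivative of w^μ is the falling factorial of μ times w^(μ-k). Differentiating this in
μ gives the k-th derivative of w^μ log w, hence the derivative of the falling factorial. -/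
theorem iteratedDeriv_frobFun {ζ : ℂ} {θ ρ : ℝ} (l : ℂ) {h p : ℕ → ℂ} (hh : ConvBound ρ h)
    (hp : ConvBound ρ p) (k : ℕ) : ∀ z ∈ slitDisc ζ θ ρ,
    iteratedDeriv k (frobFun ζ θ l h p) z = frobFun ζ θ (l - k)
      (fun n => (descPochhammer ℂ k).eval (l + n) * h n +
        (descPochhammer ℂ k).derivative.eval (l + n) * p n)
      (fun n => (descPochhammer ℂ k).eval (l + n) * p n) z := by
  induction k with
  | zero => intro z hz; simp
  | succ k ih =>
    intro z hz
    have heq : iteratedDeriv k (frobFun ζ θ l h p) =ᶠ[𝓝 z] frobFun ζ θ (l - k)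
      (fun n => (descPochhammer ℂ k).eval (l + n) * h n +
        (descPochhammer ℂ k).derivative.eval (l + n) * p n)
      (fun n => (descPochhammer ℂ k).eval (l + n) * p n) :=
      Filter.eventually_of_mem ((isOpen_slitDisc ζ θ ρ).mem_nhds hz) ih
    rw [iteratedDeriv_succ, heq.deriv_eq, (hasDerivAt_frobFun (l - k)
      ((hh.eval_mul _ l).add (hp.eval_mul _ l)) (hp.eval_mul _ l) hz).deriv]
    have : l - k - 1 = l - (k + 1 : ℕ) := by push_cast; ring
    rw [this]
    congr 1
    · funext n
      simp only [descPochhammer_succ_right, Polynomial.derivative_mul, Polynomial.eval_mul,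
        Polynomial.eval_add, Polynomial.eval_sub, Polynomial.eval_X, Polynomial.eval_natCast,
        Polynomial.derivative_sub, Polynomial.derivative_X, Polynomial.derivative_natCast,
        Polynomial.eval_one, Polynomial.eval_zero]
      ring
    · funext n
      simp only [descPochhammer_succ_right, Polynomial.eval_mul,
        Polynomial.eval_sub, Polynomial.eval_X, Polynomial.eval_natCast]
      ring

/-! ### The differential operator on Frobenius series -/

/-- The polynomials `P_k` with `z ^ r * L (z ^ μ) = ∑ P_k(μ) z ^ (μ + k)`, where `L` is the
differential operator with coefficients `z ^ (-i) * ∑ c i k z ^ k`. -/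
noncomputable def frobPoly (r : ℕ) (c : ℕ → ℕ → ℂ) (k : ℕ) : Polynomial ℂ :=
  ∑ i ∈ Finset.range (r + 1), Polynomial.C (c i k) * descPochhammer ℂ (r - i)

theorem frobPoly_eval (r : ℕ) (c : ℕ → ℕ → ℂ) (k : ℕ) (x : ℂ) : (frobPoly r c k).eval x =
    ∑ i ∈ Finset.range (r + 1), c i k * (descPochhammer ℂ (r - i)).eval x := by
  simp [frobPoly, Polynomial.eval_finsetSum]

theorem frobPoly_derivative_eval (r : ℕ) (c : ℕ → ℕ → ℂ) (k : ℕ) (x : ℂ) :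
    (frobPoly r c k).derivative.eval x =
    ∑ i ∈ Finset.range (r + 1), c i k * (descPochhammer ℂ (r - i)).derivative.eval x := by
  simp [frobPoly, Polynomial.eval_finsetSum]

theorem sum_seriesSum_mul_eq_zero {r : ℕ} {ρ : ℝ} {c d : ℕ → ℕ → ℂ}
    (hc : ∀ i ∈ Finset.range (r + 1), ConvBound ρ (c i))
    (hd : ∀ i ∈ Finset.range (r + 1), ConvBound ρ (d i))
    (h : ∀ n, ∑ j ∈ Finset.range (n + 1), ∑ i ∈ Finset.range (r + 1), c i (n - j) * d i j = 0)
    {w : ℂ} (hw : ‖w‖ < ρ) :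
    ∑ i ∈ Finset.range (r + 1), seriesSum (c i) w * seriesSum (d i) w = 0 := by
  have h1 := hasSum_sum fun i hi => (hc i hi).hasSum_mul (hd i hi) hw
  refine h1.unique ?_
  suffices he : (fun n => ∑ i ∈ Finset.range (r + 1),
      (∑ j ∈ Finset.range (n + 1), c i (n - j) * d i j) * w ^ n) = fun _ => 0 by
    rw [he]
    exact hasSum_zero
  funext n
  rw [← Finset.sum_mul, Finset.sum_comm, h n, zero_mul]

theorem pow_mul_odeOperator (r : ℕ) (a : ℕ → ℂ → ℂ) (Y : ℂ → ℂ) (w z : ℂ) {A : ℕ → ℂ}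
    (hA0 : A 0 = 1) (hA : ∀ i ∈ Finset.Icc 1 r, w ^ i * a i z = A i) :
    w ^ r * odeOperator r a Y z =
      ∑ i ∈ Finset.range (r + 1), A i * (w ^ (r - i) * iteratedDeriv (r - i) Y z) := by
  rw [odeOperator, Finset.sum_range_succ', hA0, mul_add, Finset.mul_sum, add_comm]
  congr 1
  · rw [Finset.range_eq_Ico, Finset.sum_Ico_add' (fun i => A i * (w ^ (r - i) * iteratedDeriv (r - i) Y z)) 0 r 1]
    rw [zero_add]
    have : Finset.Ico 1 (r + 1) = Finset.Icc 1 r := rfl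
    rw [this]
    refine Finset.sum_congr rfl fun i hi => ?_
    rw [← hA i hi]
    have hi' := (Finset.mem_Icc.mp hi).2
    have : w ^ r = w ^ i * w ^ (r - i) := by rw [← pow_add, Nat.add_sub_cancel' hi']
    rw [this]
    ring
  · simp

/-- After multiplication by w^r, `E1` makes every coefficient of the part containing log w vanish,
and `E2` every coefficient of the rest. -/
theorem isAnalyticSolutionOn_frobFun {r : ℕ} {a : ℕ → ℂ → ℂ} {ζ : ℂ} {θ ρ : ℝ} {c : ℕ → ℕ → ℂ}
    (hc : ∀ i ∈ Finset.range (r + 1), ConvBound ρ (c i))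
    (hc0 : ∀ k, c 0 k = if k = 0 then 1 else 0)
    (ha : ∀ i ∈ Finset.Icc 1 r, ∀ z ≠ ζ, ‖z - ζ‖ < ρ →
      (z - ζ) ^ i * a i z = seriesSum (c i) (z - ζ))
    {l : ℂ} {h p : ℕ → ℂ} (hh : ConvBound ρ h) (hp : ConvBound ρ p)
    (E1 : ∀ k, ∑ j ∈ Finset.range (k + 1), (frobPoly r c (k - j)).eval (l + j) * p j = 0)
    (E2 : ∀ k, ∑ j ∈ Finset.range (k + 1), ((frobPoly r c (k - j)).eval (l + j) * h j +
      (frobPoly r c (k - j)).derivative.eval (l + j) * p j) = 0) :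
    IsAnalyticSolutionOn r a (slitDisc ζ θ ρ) (frobFun ζ θ l h p) := by
  refine ⟨analyticOnNhd_frobFun l hh hp, fun z hz => ?_⟩
  have hw := norm_sub_lt_of_mem_slitDisc hz
  have hw0 := sub_ne_zero_of_mem_slitDisc hz
  have hA0 : seriesSum (c 0) (z - ζ) = 1 := by
    rw [seriesSum, tsum_eq_single 0]
    · simp [hc0]
    · intro n hn
      simp [hc0, hn]
  have key := pow_mul_odeOperator r a (frobFun ζ θ l h p) (z - ζ) z
    (A := fun i => seriesSum (c i) (z - ζ)) hA0
    fun i hi => ha i hi z (sub_ne_zero.mp hw0) hw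
  refine (mul_eq_zero.mp (key.trans ?_)).resolve_left (pow_ne_zero _ hw0)
  have h2 := sum_seriesSum_mul_eq_zero hc (fun i _ => hp.eval_mul (descPochhammer ℂ (r - i)) l)
    (fun n => by
      rw [← E1 n]
      refine Finset.sum_congr rfl fun j _ => ?_
      rw [frobPoly_eval, Finset.sum_mul]
      exact Finset.sum_congr rfl fun i _ => by ring) hw
  have h1 := sum_seriesSum_mul_eq_zero hc (fun i _ => (hh.eval_mul (descPochhammer ℂ (r - i)) l).add
      (hp.eval_mul (descPochhammer ℂ (r - i)).derivative l))
    (fun n => by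
      rw [← E2 n]
      refine Finset.sum_congr rfl fun j _ => ?_
      rw [frobPoly_eval, frobPoly_derivative_eval, Finset.sum_mul, Finset.sum_mul,
        ← Finset.sum_add_distrib]
      exact Finset.sum_congr rfl fun i _ => by ring) hw
  have h3 : ∀ i ∈ Finset.range (r + 1), seriesSum (c i) (z - ζ) *
      ((z - ζ) ^ (r - i) * iteratedDeriv (r - i) (frobFun ζ θ l h p) z) =
      powBranch θ (z - ζ) l * (seriesSum (c i) (z - ζ) * seriesSum (fun n =>
        (descPochhammer ℂ (r - i)).eval (l + n) * h n +
        (descPochhammer ℂ (r - i)).derivative.eval (l + n) * p n) (z - ζ)) +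
      powBranch θ (z - ζ) l * logBranch θ (z - ζ) * (seriesSum (c i) (z - ζ) *
        seriesSum (fun n => (descPochhammer ℂ (r - i)).eval (l + n) * p n) (z - ζ)) := by
    intro i _
    rw [iteratedDeriv_frobFun l hh hp _ z hz, frobFun, powBranch_sub_natCast θ hw0]
    have := pow_ne_zero (r - i) hw0
    field_simp
  rw [Finset.sum_congr rfl h3, Finset.sum_add_distrib, ← Finset.mul_sum, ← Finset.mul_sum, h1, h2]
  simp

/-! ### Solving the recursion with convergent series -/

/-- A sequence can be defined by strong recursion. -/
theorem exists_strong_recursion {E : Type*} [Zero E] (step : ℕ → (ℕ → E) → E) :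
    ∃ u : ℕ → E, ∀ k, u k = step k (fun j => if j < k then u j else 0) := by
  refine ⟨Nat.strongRec (fun k ih => step k fun j => if hj : j < k then ih j hj else 0),
    fun k => ?_⟩
  beta_reduce
  rw [Nat.strongRec_eq]
  congr 1

/-- A discrete Grönwall argument: the partial sums S k of v j / K^j satisfy S (k+1) ≤ (1+C) S k from
N on. -/
theorem exists_geometric_bound {v : ℕ → ℝ} (hv : ∀ n, 0 ≤ v n) {C K : ℝ} (hC : 0 ≤ C) (hK : 0 < K)
    (N : ℕ) (h : ∀ k ≥ N, v k ≤ C * ∑ j ∈ Finset.range k, K ^ (k - j) * v j) :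
    ∃ M T : ℝ, 0 < T ∧ ∀ n, v n ≤ M * T ^ n := by
  set S : ℕ → ℝ := fun k => ∑ j ∈ Finset.range k, v j / K ^ j with hS
  have hS0 : ∀ k, 0 ≤ S k := fun k => Finset.sum_nonneg fun j _ => by have := hv j; positivity
  have hmono : Monotone S := monotone_nat_of_le_succ fun k => by
    rw [hS]
    simp only [Finset.sum_range_succ]
    have := hv k
    linarith [show 0 ≤ v k / K ^ k by positivity]
  have hstep : ∀ k ≥ N, S (k + 1) ≤ (1 + C) * S k := by
    intro k hk
    have h1 : v k / K ^ k ≤ C * S k := by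
      rw [div_le_iff₀ (by positivity)]
      refine (h k hk).trans (le_of_eq ?_)
      rw [mul_assoc, hS]
      simp only []
      rw [Finset.sum_mul]
      congr 1
      refine Finset.sum_congr rfl fun j hj => ?_
      have : K ^ k = K ^ j * K ^ (k - j) := by
        rw [← pow_add, Nat.add_sub_cancel' (Finset.mem_range.mp hj).le]
      rw [this]
      field_simp
    have h2 : S (k + 1) = S k + v k / K ^ k := Finset.sum_range_succ _ _
    linarith
  have hb : ∀ k, S k ≤ S N * (1 + C) ^ k := by
    intro k
    induction k with
    | zero => simpa using hmono (Nat.zero_le N)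
    | succ k ih =>
      rcases le_or_gt N k with hk | hk
      · calc S (k + 1) ≤ (1 + C) * S k := hstep k hk
          _ ≤ (1 + C) * (S N * (1 + C) ^ k) := by gcongr
          _ = _ := by ring
      · calc S (k + 1) ≤ S N * 1 := by rw [mul_one]; exact hmono hk
          _ ≤ _ := by
            gcongr
            · exact hS0 N
            · exact one_le_pow₀ (by linarith)
  refine ⟨S N * (1 + C), K * (1 + C), by positivity, fun n => ?_⟩
  have h1 : v n / K ^ n ≤ S (n + 1) :=
    Finset.single_le_sum (f := fun j => v j / K ^ j) (fun j _ => by have := hv j; positivity)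
      (Finset.self_mem_range_succ n)
  have h2 := h1.trans (hb (n + 1))
  rw [div_le_iff₀ (by positivity)] at h2
  refine h2.trans (le_of_eq ?_)
  rw [mul_pow, pow_succ]
  ring

theorem exists_norm_frobPoly_le {r : ℕ} {c : ℕ → ℕ → ℂ} {M K : ℝ} (hK : 0 < K)
    (hc : ∀ i ∈ Finset.range (r + 1), ∀ k, ‖c i k‖ ≤ M * K ^ k) (l : ℂ) :
    ∃ Q : ℝ, 0 ≤ Q ∧ ∀ k j : ℕ,
      ‖(frobPoly r c k).eval (l + j)‖ ≤ Q * K ^ k * ((j : ℝ) + 1) ^ r ∧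
      ‖(frobPoly r c k).derivative.eval (l + j)‖ ≤ Q * K ^ k * ((j : ℝ) + 1) ^ r := by
  have hM : 0 ≤ M := by simpa using (norm_nonneg _).trans (hc 0 (by simp) 0)
  have hdeg : ∀ i, (descPochhammer ℂ (r - i)).natDegree ≤ r := fun i => by
    rw [descPochhammer_natDegree]; omega
  choose C hC hCq using fun i => exists_norm_eval_le (descPochhammer ℂ (r - i)) l r (hdeg i)
  choose D hD hDq using fun i => exists_norm_eval_le (descPochhammer ℂ (r - i)).derivative l r
    ((Polynomial.natDegree_derivative_le _).trans ((Nat.sub_le _ _).trans (hdeg i)))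
  refine ⟨∑ i ∈ Finset.range (r + 1), M * (C i + D i),
    Finset.sum_nonneg fun i _ => by have := hC i; have := hD i; positivity, fun k j => ⟨?_, ?_⟩⟩
  · rw [frobPoly_eval, Finset.sum_mul, Finset.sum_mul]
    refine (norm_sum_le _ _).trans (Finset.sum_le_sum fun i hi => ?_)
    rw [norm_mul]
    calc _ ≤ M * K ^ k * (C i * ((j : ℝ) + 1) ^ r) := by
            gcongr
            · exact hc i hi k
            · exact hCq i j
      _ ≤ M * K ^ k * ((C i + D i) * ((j : ℝ) + 1) ^ r) := by
            gcongr
            linarith [hD i]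
      _ = _ := by ring
  · rw [frobPoly_derivative_eval, Finset.sum_mul, Finset.sum_mul]
    refine (norm_sum_le _ _).trans (Finset.sum_le_sum fun i hi => ?_)
    rw [norm_mul]
    calc _ ≤ M * K ^ k * (D i * ((j : ℝ) + 1) ^ r) := by
            gcongr
            · exact hc i hi k
            · exact hDq i j
      _ ≤ M * K ^ k * ((C i + D i) * ((j : ℝ) + 1) ^ r) := by
            gcongr
            linarith [hC i]
      _ = _ := by ring

/-- Solution of the recursion of the Frobenius method. At the resonant indices, the
coefficient of the logarithm is used to solve the second equation. -/
theorem exists_frobenius_coefficients {r : ℕ} {c : ℕ → ℕ → ℂ} {M K : ℝ} (hK : 0 < K)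
    (hc : ∀ i ∈ Finset.range (r + 1), ∀ k, ‖c i k‖ ≤ M * K ^ k) (l h₀ p₀ : ℂ)
    (hlow : ∃ ε : ℝ, 0 < ε ∧ ∀ᶠ k : ℕ in atTop,
      ε * ((k : ℝ) + 1) ^ r ≤ ‖(frobPoly r c 0).eval (l + k)‖) :
    ∃ h p : ℕ → ℂ, h 0 = h₀ ∧ p 0 = p₀ ∧
      (∃ ρ : ℝ, 0 < ρ ∧ ConvBound ρ h ∧ ConvBound ρ p) ∧ ∀ k : ℕ, 1 ≤ k →
      ((frobPoly r c 0).eval (l + k) ≠ 0 →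
        (frobPoly r c 0).eval (l + k) * p k =
          -∑ j ∈ Finset.range k, (frobPoly r c (k - j)).eval (l + j) * p j ∧
        (frobPoly r c 0).eval (l + k) * h k = -(∑ j ∈ Finset.range k,
          ((frobPoly r c (k - j)).eval (l + j) * h j +
            (frobPoly r c (k - j)).derivative.eval (l + j) * p j)) -
            (frobPoly r c 0).derivative.eval (l + k) * p k) ∧
      ((frobPoly r c 0).eval (l + k) = 0 → h k = 0 ∧
        p k = -(∑ j ∈ Finset.range k, ((frobPoly r c (k - j)).eval (l + j) * h j +
            (frobPoly r c (k - j)).derivative.eval (l + j) * p j)) /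
            (frobPoly r c 0).derivative.eval (l + k)) := by
  set P := fun k : ℕ => frobPoly r c k with hP
  let A : ℕ → (ℕ → ℂ × ℂ) → ℂ := fun k u =>
    ∑ j ∈ Finset.range k, (P (k - j)).eval (l + j) * (u j).2
  let B : ℕ → (ℕ → ℂ × ℂ) → ℂ := fun k u =>
    ∑ j ∈ Finset.range k, ((P (k - j)).eval (l + j) * (u j).1 +
      (P (k - j)).derivative.eval (l + j) * (u j).2)
  -- At a resonance h k is free and set to 0, and p k absorbs the second equation. If P_0' vanishes
  -- there as well, the quotient is 0 by convention; the recursion claims nothing more about that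
  -- case.
  let step : ℕ → (ℕ → ℂ × ℂ) → ℂ × ℂ := fun k u =>
    if k = 0 then (h₀, p₀) else
    if (P 0).eval (l + k) = 0 then (0, -B k u / (P 0).derivative.eval (l + k)) else
      ((-B k u - (P 0).derivative.eval (l + k) * (-A k u / (P 0).eval (l + k))) /
        (P 0).eval (l + k), -A k u / (P 0).eval (l + k))
  obtain ⟨u, hu⟩ := exists_strong_recursion step
  have hAt : ∀ k, A k (fun j => if j < k then u j else 0) = A k u := fun k =>
    Finset.sum_congr rfl fun j hj => by simp [Finset.mem_range.mp hj]
  have hBt : ∀ k, B k (fun j => if j < k then u j else 0) = B k u := fun k =>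
    Finset.sum_congr rfl fun j hj => by simp [Finset.mem_range.mp hj]
  have hu0 : u 0 = (h₀, p₀) := by rw [hu 0]; simp [step]
  have hres : ∀ k : ℕ, 1 ≤ k → (P 0).eval (l + k) = 0 →
      u k = (0, -B k u / (P 0).derivative.eval (l + k)) := by
    intro k hk h0
    rw [hu k]
    simp only [step, hBt]
    rw [if_neg (by omega), if_pos h0]
  have hnon : ∀ k : ℕ, 1 ≤ k → (P 0).eval (l + k) ≠ 0 →
      (u k).2 = -A k u / (P 0).eval (l + k) ∧
      (u k).1 = (-B k u - (P 0).derivative.eval (l + k) * (u k).2) / (P 0).eval (l + k) := by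
    intro k hk h0
    have : u k = ((-B k u - (P 0).derivative.eval (l + k) * (-A k u / (P 0).eval (l + k))) /
        (P 0).eval (l + k), -A k u / (P 0).eval (l + k)) := by
      conv_lhs => rw [hu k]
      simp only [step, hBt, hAt]
      rw [if_neg (by omega), if_neg h0]
    rw [this]
    exact ⟨rfl, rfl⟩
  have hbound : ∃ M T : ℝ, 0 < T ∧ ∀ n, ‖(u n).1‖ + ‖(u n).2‖ ≤ M * T ^ n := by
    obtain ⟨Q, hQ, hQP⟩ := exists_norm_frobPoly_le hK hc l
    obtain ⟨ε, hε, hlow⟩ := hlow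
    obtain ⟨N, hN⟩ := eventually_atTop.mp hlow
    -- The two summands of C bound p k and h k respectively. From N on the lower bound on P_0
    -- excludes resonances, so only the generic recursion needs an estimate.
    refine exists_geometric_bound (v := fun n => ‖(u n).1‖ + ‖(u n).2‖)
      (fun n => by positivity) (C := Q / ε + Q / ε * (1 + Q / ε)) (by positivity) hK (max N 1) ?_
    intro k hk
    have hkN : N ≤ k := (le_max_left _ _).trans hk
    have hk1 : 1 ≤ k := (le_max_right _ _).trans hk
    set V := ∑ j ∈ Finset.range k, K ^ (k - j) * (‖(u j).1‖ + ‖(u j).2‖) with hV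
    have hV0 : 0 ≤ V := Finset.sum_nonneg fun j _ => by positivity
    set L : ℝ := ((k : ℝ) + 1) ^ r with hL
    have hL0 : 0 < L := by positivity
    have hlowk := hN k hkN
    have hP0 : (P 0).eval (l + k) ≠ 0 := by
      rw [← norm_pos_iff]
      exact lt_of_lt_of_le (by positivity) hlowk
    obtain ⟨h2, h1⟩ := hnon k hk1 hP0
    have hjk : ∀ j ∈ Finset.range k, ((j : ℝ) + 1) ^ r ≤ L := fun j hj => by
      have : (j : ℝ) ≤ k := by exact_mod_cast (Finset.mem_range.mp hj).le
      exact pow_le_pow_left₀ (by positivity) (by linarith) r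
    have hA : ‖A k u‖ ≤ Q * L * V := by
      refine (norm_sum_le _ _).trans ?_
      rw [hV, Finset.mul_sum]
      refine Finset.sum_le_sum fun j hj => ?_
      rw [norm_mul]
      calc _ ≤ Q * K ^ (k - j) * L * (‖(u j).1‖ + ‖(u j).2‖) := by
              gcongr
              · exact (hQP _ _).1.trans (by gcongr; exact hjk j hj)
              · linarith [norm_nonneg (u j).1]
        _ = _ := by ring
    have hB : ‖B k u‖ ≤ Q * L * V := by
      refine (norm_sum_le _ _).trans ?_
      rw [hV, Finset.mul_sum]
      refine Finset.sum_le_sum fun j hj => ?_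
      refine (norm_add_le _ _).trans ?_
      rw [norm_mul, norm_mul]
      calc _ ≤ Q * K ^ (k - j) * L * ‖(u j).1‖ + Q * K ^ (k - j) * L * ‖(u j).2‖ := by
              gcongr
              · exact (hQP _ _).1.trans (by gcongr; exact hjk j hj)
              · exact (hQP _ _).2.trans (by gcongr; exact hjk j hj)
        _ = _ := by ring
    have h2' : ‖(u k).2‖ ≤ Q / ε * V := by
      rw [h2, norm_div, norm_neg]
      calc _ ≤ Q * L * V / (ε * L) := by gcongr
        _ = _ := by field_simp
    have h1' : ‖(u k).1‖ ≤ Q / ε * (1 + Q / ε) * V := by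
      rw [h1, norm_div]
      have hD := (hQP 0 k).2
      rw [pow_zero, mul_one] at hD
      calc _ ≤ (Q * L * V + Q * L * (Q / ε * V)) / (ε * L) := by
              gcongr
              refine (norm_sub_le _ _).trans ?_
              rw [norm_neg, norm_mul]
              gcongr
        _ = _ := by field_simp
    linarith
  obtain ⟨M', T, hT, hMT⟩ := hbound
  refine ⟨fun n => (u n).1, fun n => (u n).2, congrArg Prod.fst hu0, congrArg Prod.snd hu0, ⟨T⁻¹, inv_pos.mpr hT,
    convBound_of_geometric hT fun n => le_trans (by linarith [norm_nonneg (u n).2]) (hMT n),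
    convBound_of_geometric hT fun n => le_trans (by linarith [norm_nonneg (u n).1]) (hMT n)⟩,
    fun k hk => ⟨fun h0 => ?_, fun h0 => ?_⟩⟩
  · obtain ⟨h2, h1⟩ := hnon k hk h0
    replace h0 : (P 0).eval (l + k) ≠ 0 := h0
    constructor
    · change (P 0).eval (l + k) * (u k).2 = -A k u
      rw [h2]
      field_simp
    · change (P 0).eval (l + k) * (u k).1 = -B k u - (P 0).derivative.eval (l + k) * (u k).2
      rw [h1]
      field_simp
  · have := hres k hk h0
    beta_reduce
    rw [this]
    exact ⟨rfl, rfl⟩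

/-! ### Falling factorials and the indicial polynomial -/

theorem eventually_half_le_norm_add_natCast (a : ℂ) :
    ∀ᶠ k : ℕ in atTop, (1 / 2 : ℝ) * ((k : ℝ) + 1) ≤ ‖a + k‖ := by
  filter_upwards [eventually_ge_atTop ⌈2 * ‖a‖ + 1⌉₊] with k hk
  have h1 : 2 * ‖a‖ + 1 ≤ k := (Nat.le_ceil _).trans (by exact_mod_cast hk)
  have h2 : (k : ℝ) ≤ ‖a + k‖ + ‖a‖ := by
    have := norm_sub_le (a + k) a
    rwa [add_sub_cancel_left, Complex.norm_natCast] at this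
  linarith

theorem exists_le_norm_descPochhammer_eval (l : ℂ) (n : ℕ) :
    ∃ ε : ℝ, 0 < ε ∧ ∀ᶠ k : ℕ in atTop,
      ε * ((k : ℝ) + 1) ^ n ≤ ‖(descPochhammer ℂ n).eval (l + k)‖ := by
  induction n with
  | zero => exact ⟨1, one_pos, by simp⟩
  | succ n ih =>
    obtain ⟨ε, hε, h⟩ := ih
    refine ⟨ε * (1 / 2), by positivity, ?_⟩
    filter_upwards [h, eventually_half_le_norm_add_natCast (l - n)] with k h1 h2
    rw [descPochhammer_succ_eval, norm_mul, show l + k - n = l - n + k by ring]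
    calc _ = ε * ((k : ℝ) + 1) ^ n * (1 / 2 * ((k : ℝ) + 1)) := by ring
      _ ≤ _ := by gcongr

theorem descPochhammer_eval_eq_zero_iff (n : ℕ) (x : ℂ) :
    (descPochhammer ℂ n).eval x = 0 ↔ ∃ i < n, x = (i : ℕ) := by
  induction n with
  | zero => simp
  | succ n ih =>
    rw [descPochhammer_succ_eval, mul_eq_zero, ih, sub_eq_zero]
    constructor
    · rintro (⟨i, hi, h⟩ | h)
      · exact ⟨i, by omega, h⟩
      · exact ⟨n, by omega, h⟩
    · rintro ⟨i, hi, h⟩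
      rcases Nat.lt_succ_iff_lt_or_eq.mp hi with hi | rfl
      · exact Or.inl ⟨i, hi, h⟩
      · exact Or.inr h

theorem descPochhammer_derivative_eval_ne_zero {n i : ℕ} (hi : i < n) :
    (descPochhammer ℂ n).derivative.eval (i : ℂ) ≠ 0 := by
  induction n with
  | zero => omega
  | succ n ih =>
    have h : (descPochhammer ℂ (n + 1)).derivative.eval (i : ℂ) =
        (descPochhammer ℂ n).derivative.eval (i : ℂ) * (i - n) +
          (descPochhammer ℂ n).eval (i : ℂ) := by
      simp [descPochhammer_succ_right, Polynomial.derivative_mul]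
    rw [h]
    rcases Nat.lt_succ_iff_lt_or_eq.mp hi with hi | rfl
    · rw [(descPochhammer_eval_eq_zero_iff n i).mpr ⟨i, hi, rfl⟩, add_zero]
      exact mul_ne_zero (ih hi) (sub_ne_zero.mpr (by exact_mod_cast hi.ne))
    · rw [sub_self, mul_zero, zero_add, Ne, descPochhammer_eval_eq_zero_iff]
      rintro ⟨j, hj, h⟩
      have : i = j := by exact_mod_cast h
      omega

/-- Term by term: for i > k + 1 the coefficient c i k vanishes, and for i ≤ k + 1 the falling
factorial of length r - i > m vanishes at m. -/
theorem frobPoly_eval_natCast_eq_zero {r : ℕ} {c : ℕ → ℕ → ℂ} (hcv : ∀ i k, k + 1 < i → c i k = 0)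
    {k m : ℕ} (h : m + k + 1 < r) : (frobPoly r c k).eval (m : ℂ) = 0 := by
  rw [frobPoly_eval]
  refine Finset.sum_eq_zero fun i _ => ?_
  rcases lt_or_ge (k + 1) i with hi | hi
  · rw [hcv i k hi, zero_mul]
  · rw [(descPochhammer_eval_eq_zero_iff _ _).mpr ⟨m, by omega, rfl⟩, mul_zero]

/-- The indicial polynomial. -/
theorem frobPoly_zero {s : ℕ} {c : ℕ → ℕ → ℂ} (hc0 : c 0 0 = 1)
    (hcv : ∀ i k, k + 1 < i → c i k = 0) : frobPoly (s + 1) c 0 =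
      descPochhammer ℂ s * (Polynomial.X - Polynomial.C (s - c 1 0)) := by
  rw [frobPoly, Finset.sum_range_succ', Finset.sum_range_succ', Finset.sum_eq_zero]
  · simp [hc0, descPochhammer_succ_right]
    ring
  · intro i _
    rw [hcv _ _ (by omega)]
    simp

theorem frobPoly_zero_eval {s : ℕ} {c : ℕ → ℕ → ℂ} (hc0 : c 0 0 = 1)
    (hcv : ∀ i k, k + 1 < i → c i k = 0) (x : ℂ) : (frobPoly (s + 1) c 0).eval x =
      (descPochhammer ℂ s).eval x * (x - (s - c 1 0)) := by
  rw [frobPoly_zero hc0 hcv]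
  simp

theorem frobPoly_zero_derivative_eval {s : ℕ} {c : ℕ → ℕ → ℂ} (hc0 : c 0 0 = 1)
    (hcv : ∀ i k, k + 1 < i → c i k = 0) (x : ℂ) : (frobPoly (s + 1) c 0).derivative.eval x =
      (descPochhammer ℂ s).derivative.eval x * (x - (s - c 1 0)) +
        (descPochhammer ℂ s).eval x := by
  rw [frobPoly_zero hc0 hcv]
  simp [Polynomial.derivative_mul]

theorem exists_le_norm_frobPoly_zero {s : ℕ} {c : ℕ → ℕ → ℂ} (hc0 : c 0 0 = 1)
    (hcv : ∀ i k, k + 1 < i → c i k = 0) (l : ℂ) :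
    ∃ ε : ℝ, 0 < ε ∧ ∀ᶠ k : ℕ in atTop,
      ε * ((k : ℝ) + 1) ^ (s + 1) ≤ ‖(frobPoly (s + 1) c 0).eval (l + k)‖ := by
  obtain ⟨ε, hε, h⟩ := exists_le_norm_descPochhammer_eval l s
  refine ⟨ε * (1 / 2), by positivity, ?_⟩
  filter_upwards [h, eventually_half_le_norm_add_natCast (l - (s - c 1 0))] with k h1 h2
  rw [frobPoly_zero_eval hc0 hcv, norm_mul,
    show l + k - (s - c 1 0) = l - (s - c 1 0) + k by ring]
  calc _ = ε * ((k : ℝ) + 1) ^ s * (1 / 2 * ((k : ℝ) + 1)) := by ring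
    _ ≤ _ := by gcongr

/-! ### Coefficients at each exponent, and resonances -/

/-- By `hres` the obstruction at a resonance vanishes term by term, whatever the earlier
coefficients are. Starting the logarithmic series at 0 therefore keeps it at 0. -/
theorem exists_log_free_coefficients {s : ℕ} {c : ℕ → ℕ → ℂ} {M K : ℝ} (hK : 0 < K)
    (hc : ∀ i ∈ Finset.range (s + 1 + 1), ∀ k, ‖c i k‖ ≤ M * K ^ k) (hc0 : c 0 0 = 1)
    (hcv : ∀ i k, k + 1 < i → c i k = 0) {l : ℂ} (hl : (frobPoly (s + 1) c 0).eval l = 0)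
    (hres : ∀ k : ℕ, 1 ≤ k → (frobPoly (s + 1) c 0).eval (l + k) = 0 →
      ∀ j < k, (frobPoly (s + 1) c (k - j)).eval (l + j) = 0) :
    ∃ h : ℕ → ℂ, h 0 = 1 ∧ (∃ ρ : ℝ, 0 < ρ ∧ ConvBound ρ h) ∧
      ∀ k, ∑ j ∈ Finset.range (k + 1), (frobPoly (s + 1) c (k - j)).eval (l + j) * h j = 0 := by
  obtain ⟨h, p, hh0, hp0, ⟨ρ, hρ, hh, -⟩, hrec⟩ := exists_frobenius_coefficients hK hc l 1 0
    (exists_le_norm_frobPoly_zero hc0 hcv l)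
  have hp : ∀ k, p k = 0 := by
    intro k
    induction k using Nat.strong_induction_on with
    | _ k ih =>
      rcases Nat.eq_zero_or_pos k with rfl | hk
      · exact hp0
      obtain ⟨r1, r2⟩ := hrec k hk
      by_cases h0 : (frobPoly (s + 1) c 0).eval (l + k) = 0
      -- The numerator is 0, so it does not matter whether the derivative in the denominator
      -- vanishes.
      · rw [(r2 h0).2, Finset.sum_eq_zero, neg_zero, zero_div]
        intro j hj
        have hj := Finset.mem_range.mp hj
        rw [hres k hk h0 j hj, ih j hj]
        ring
      · have := (r1 h0).1
        rw [Finset.sum_eq_zero, neg_zero] at this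
        · exact (mul_eq_zero.mp this).resolve_left h0
        · intro j hj
          rw [ih j (Finset.mem_range.mp hj), mul_zero]
  refine ⟨h, hh0, ⟨ρ, hρ, hh⟩, fun k => ?_⟩
  rw [Finset.sum_range_succ, Nat.sub_self]
  rcases Nat.eq_zero_or_pos k with rfl | hk
  · simp [hl]
  by_cases h0 : (frobPoly (s + 1) c 0).eval (l + k) = 0
  · rw [h0, zero_mul, add_zero]
    refine Finset.sum_eq_zero fun j hj => ?_
    rw [hres k hk h0 j (Finset.mem_range.mp hj), zero_mul]
  · rw [((hrec k hk).1 h0).2, hp k]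
    simp only [hp, mul_zero, add_zero, sub_zero]
    ring

/-- The resonant k ≥ 1 are those for which s - n + k is one of 0, …, s - 1. Such a zero of P_0 is
simple, since the other root s - n lies k below it. The condition on p₀ keeps negative powers out of
the coefficient of the logarithm. -/
theorem exists_resonant_coefficients {s : ℕ} {c : ℕ → ℕ → ℂ} {M K : ℝ} (hK : 0 < K)
    (hc : ∀ i ∈ Finset.range (s + 1 + 1), ∀ k, ‖c i k‖ ≤ M * K ^ k) (hc0 : c 0 0 = 1)
    (hcv : ∀ i k, k + 1 < i → c i k = 0) {n : ℕ} (hn : 1 ≤ n) (hc1 : c 1 0 = n) {h₀ p₀ : ℂ}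
    (hp₀ : s < n → p₀ = 0) :
    ∃ h p : ℕ → ℂ, h 0 = h₀ ∧ p 0 = p₀ ∧ (∃ ρ : ℝ, 0 < ρ ∧ ConvBound ρ h ∧ ConvBound ρ p) ∧
      (∀ k, k + s < n → p k = 0) ∧ (∀ k, 1 ≤ k → k < n → n ≤ k + s → h k = 0) ∧
      (∀ k, ∑ j ∈ Finset.range (k + 1),
        (frobPoly (s + 1) c (k - j)).eval ((s : ℂ) - n + j) * p j = 0) ∧
      (∀ k, ∑ j ∈ Finset.range (k + 1), ((frobPoly (s + 1) c (k - j)).eval ((s : ℂ) - n + j) * h j +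
        (frobPoly (s + 1) c (k - j)).derivative.eval ((s : ℂ) - n + j) * p j) = 0) := by
  obtain ⟨h, p, hh0, hp0, hρ, hrec⟩ := exists_frobenius_coefficients hK hc ((s : ℂ) - n) h₀ p₀
    (exists_le_norm_frobPoly_zero hc0 hcv _)
  have hcast : ∀ k : ℕ, n ≤ k + s → (s : ℂ) - n + k = ((k + s - n : ℕ) : ℂ) := by
    intro k hk
    push_cast [Nat.cast_sub hk]
    ring
  have heval : ∀ k : ℕ, (frobPoly (s + 1) c 0).eval ((s : ℂ) - n + k) =
      (descPochhammer ℂ s).eval ((s : ℂ) - n + k) * k := by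
    intro k
    rw [frobPoly_zero_eval hc0 hcv, hc1]
    ring
  have hzero : ∀ k : ℕ, 1 ≤ k →
      ((frobPoly (s + 1) c 0).eval ((s : ℂ) - n + k) = 0 ↔ n ≤ k + s ∧ k < n) := by
    intro k hk
    have hk0 : (k : ℂ) ≠ 0 := by exact_mod_cast (by omega : k ≠ 0)
    rw [heval, mul_eq_zero, or_iff_left hk0, descPochhammer_eval_eq_zero_iff]
    constructor
    · rintro ⟨i, hi, h⟩
      have : (s : ℂ) + k = i + n := by linear_combination h
      have : s + k = i + n := by exact_mod_cast this
      omega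
    · rintro ⟨h1, h2⟩
      exact ⟨k + s - n, by omega, hcast k h1⟩
  have hderiv : ∀ k : ℕ, 1 ≤ k → n ≤ k + s → k < n →
      (frobPoly (s + 1) c 0).derivative.eval ((s : ℂ) - n + k) ≠ 0 := by
    intro k hk h1 h2
    have hk0 : (k : ℂ) ≠ 0 := by exact_mod_cast (by omega : k ≠ 0)
    rw [frobPoly_zero_derivative_eval hc0 hcv, hc1, add_sub_cancel_left, hcast k h1,
      (descPochhammer_eval_eq_zero_iff _ _).mpr ⟨k + s - n, by omega, rfl⟩, add_zero]
    exact mul_ne_zero (descPochhammer_derivative_eval_ne_zero (by omega)) hk0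
  have hp : ∀ k, k + s < n → p k = 0 := by
    intro k
    induction k using Nat.strong_induction_on with
    | _ k ih =>
      intro hks
      rcases Nat.eq_zero_or_pos k with rfl | hk
      · rw [hp0, hp₀ (by omega)]
      have h0 : (frobPoly (s + 1) c 0).eval ((s : ℂ) - n + k) ≠ 0 := by
        rw [Ne, hzero k hk]
        omega
      have := ((hrec k hk).1 h0).1
      rw [Finset.sum_eq_zero, neg_zero] at this
      · exact (mul_eq_zero.mp this).resolve_left h0
      · intro j hj
        have hj := Finset.mem_range.mp hj
        rw [ih j hj (by omega), mul_zero]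
  refine ⟨h, p, hh0, hp0, hρ, hp, fun k hk h1 h2 =>
    ((hrec k hk).2 ((hzero k hk).mpr ⟨h2, h1⟩)).1, fun k => ?_, fun k => ?_⟩
  · rw [Finset.sum_range_succ, Nat.sub_self]
    rcases Nat.eq_zero_or_pos k with rfl | hk
    · simp only [zero_add, Finset.range_zero, Finset.sum_empty, mul_eq_zero]
      left
      simpa using heval 0
    by_cases h0 : (frobPoly (s + 1) c 0).eval ((s : ℂ) - n + k) = 0
    · obtain ⟨h1, h2⟩ := (hzero k hk).mp h0
      rw [h0, zero_mul, add_zero]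
      refine Finset.sum_eq_zero fun j hj => ?_
      have hj := Finset.mem_range.mp hj
      -- Consistency of the first system at a resonance: at negative exponents p j is 0, and at
      -- natural exponents the polynomial vanishes because (s - n + j) + (k - j) < s.
      rcases lt_or_ge (j + s) n with hjs | hjs
      · rw [hp j hjs, mul_zero]
      · rw [hcast j hjs, frobPoly_eval_natCast_eq_zero hcv (by omega), zero_mul]
    · rw [((hrec k hk).1 h0).1, add_neg_cancel]
  · rw [Finset.sum_range_succ, Nat.sub_self]
    rcases Nat.eq_zero_or_pos k with rfl | hk
    · have e0 := heval 0
      rw [Nat.cast_zero, mul_zero] at e0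
      rw [Finset.sum_range_zero, Nat.cast_zero, e0, zero_mul, zero_add, zero_add, hp0]
      -- At k = 0 the second equation reduces to P_0'(s-n) p 0 = 0. If n ≤ s it holds because s - n
      -- is then a double root of P_0.
      rcases lt_or_ge s n with hs | hs
      · rw [hp₀ hs, mul_zero]
      · have := hcast 0 (by omega)
        rw [Nat.cast_zero] at this
        rw [frobPoly_zero_derivative_eval hc0 hcv, hc1, add_sub_cancel_left, mul_zero, zero_add, this,
          (descPochhammer_eval_eq_zero_iff _ _).mpr ⟨_, by omega, rfl⟩, zero_mul]
    by_cases h0 : (frobPoly (s + 1) c 0).eval ((s : ℂ) - n + k) = 0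
    · obtain ⟨h1, h2⟩ := (hzero k hk).mp h0
      have hd := hderiv k hk h1 h2
      rw [h0, zero_mul, zero_add, ((hrec k hk).2 h0).2, mul_div_cancel₀ _ hd, add_neg_cancel]
    · rw [((hrec k hk).1 h0).2]
      ring

/-! ### Expansion of the coefficients at the singular point -/

/-- Order `⊤` is excluded because `untop₀` sends it to 0, which would make the pole order 0. -/
theorem meromorphicOrderAt_eq_neg_one {f : ℂ → ℂ} {ζ : ℂ} (h : poleOrder f ζ = 1) :
    meromorphicOrderAt f ζ = ((-1 : ℤ) : WithTop ℤ) := by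
  rw [poleOrder] at h
  cases ho : meromorphicOrderAt f ζ with
  | top => simp [ho] at h
  | coe n =>
    rw [ho, WithTop.untop₀_coe] at h
    congr 1
    omega

theorem exists_series_of_simple_pole {f : ℂ → ℂ} {ζ : ℂ} (hf : MeromorphicAt f ζ)
    (h : poleOrder f ζ = 1) :
    ∃ (d : ℕ → ℂ) (M K : ℝ), d 0 ≠ 0 ∧ 0 ≤ M ∧ 1 ≤ K ∧ (∀ n, ‖d n‖ ≤ M * K ^ n) ∧
      ∀ᶠ z in 𝓝[≠] ζ, (z - ζ) * f z = seriesSum d (z - ζ) := by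
  obtain ⟨g, hg, hg0, hfg⟩ :=
    (meromorphicOrderAt_eq_int_iff hf).mp (meromorphicOrderAt_eq_neg_one h)
  obtain ⟨p, hp⟩ := hg
  obtain ⟨ρ, hp'⟩ := hp
  obtain ⟨C, K, hC, hK, hb⟩ := p.le_mul_pow_of_radius_pos (hp'.r_pos.trans_le hp'.r_le)
  -- A ratio of at least 1 lets the geometric bound survive an upward shift of the index.
  refine ⟨p.coeff, C, max K 1, ?_, hC.le, le_max_right _ _, fun n => ?_, ?_⟩
  · have := hp'.coeff_zero (fun _ => 1)
    rw [← this] at hg0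
    rw [FormalMultilinearSeries.coeff, Subsingleton.elim (1 : Fin 0 → ℂ) (fun _ => 1)]
    exact hg0
  · rw [← FormalMultilinearSeries.norm_apply_eq_norm_coef]
    refine (hb n).trans ?_
    gcongr
    exact le_max_left _ _
  · have h1 : ∀ᶠ z in 𝓝[≠] ζ, z ∈ Metric.eball ζ ρ :=
      nhdsWithin_le_nhds (Metric.eball_mem_nhds ζ hp'.r_pos)
    filter_upwards [hfg, h1, self_mem_nhdsWithin] with z hz hzρ hzζ
    have h2 := hp'.hasSum_sub hzρ
    rw [hz, seriesSum, zpow_neg_one, smul_eq_mul,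
      mul_inv_cancel_left₀ (sub_ne_zero.mpr hzζ), ← h2.tsum_eq]
    refine tsum_congr fun n => ?_
    rw [FormalMultilinearSeries.apply_eq_pow_smul_coeff, smul_eq_mul, mul_comm]

theorem exists_equation_coefficients {r : ℕ} (hr : 1 ≤ r) {a : ℕ → ℂ → ℂ} {ζ : ℂ}
    (ha : ∀ i ∈ Finset.Icc 1 r, MeromorphicAt (a i) ζ)
    (hpole : ∀ i ∈ Finset.Icc 1 r, poleOrder (a i) ζ = 1) {δ : ℂ}
    (hδ : Tendsto (fun z => (z - ζ) * a 1 z) (𝓝[≠] ζ) (𝓝 δ)) :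
    ∃ (c : ℕ → ℕ → ℂ) (M K : ℝ), 0 < K ∧
      (∀ i ∈ Finset.range (r + 1), ∀ k, ‖c i k‖ ≤ M * K ^ k) ∧
      (∀ k, c 0 k = if k = 0 then 1 else 0) ∧ (∀ i k, k + 1 < i → c i k = 0) ∧
      c 1 0 = δ ∧ δ ≠ 0 ∧ ∀ᶠ z in 𝓝[≠] ζ, ∀ i ∈ Finset.Icc 1 r,
        (z - ζ) ^ i * a i z = seriesSum (c i) (z - ζ) := by
  have hex := fun i hi => exists_series_of_simple_pole (ha i hi) (hpole i hi)
  choose! d M K hd0 hM hK hb hd using hex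
  -- For i ≥ 1 the factor (z-ζ)^i is one power for the pole times (z-ζ)^(i-1), so the series d i is
  -- shifted by i - 1 places.
  set c : ℕ → ℕ → ℂ := fun i k => if i = 0 then (if k = 0 then 1 else 0) else
    if k + 1 < i then 0 else d i (k + 1 - i) with hc
  set M' := 1 + ∑ i ∈ Finset.Icc 1 r, M i with hM'
  set K' := 1 + ∑ i ∈ Finset.Icc 1 r, K i with hK'
  have hM1 : ∀ i ∈ Finset.Icc 1 r, M i ≤ M' := fun i hi => by
    have := Finset.single_le_sum (f := M) (fun j hj => hM j hj) hi
    linarith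
  have hK1 : ∀ i ∈ Finset.Icc 1 r, K i ≤ K' := fun i hi => by
    have := Finset.single_le_sum (f := K) (fun j hj => zero_le_one.trans (hK j hj)) hi
    linarith
  have hM0 : 1 ≤ M' := by
    have := Finset.sum_nonneg (f := M) (fun j hj => hM j hj)
    linarith
  have hK0 : 1 ≤ K' := by
    have := Finset.sum_nonneg (f := K) (fun j hj => zero_le_one.trans (hK j hj))
    linarith
  have hbound : ∀ i ∈ Finset.range (r + 1), ∀ k, ‖c i k‖ ≤ M' * K' ^ k := by
    intro i hi k
    have h1 : 1 ≤ M' * K' ^ k := one_le_mul_of_one_le_of_one_le hM0 (one_le_pow₀ hK0)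
    simp only [hc]
    split_ifs with h2 h3 h4
    · simpa using h1
    · simpa using zero_le_one.trans h1
    · simpa using zero_le_one.trans h1
    · have hi' : i ∈ Finset.Icc 1 r := by
        rw [Finset.mem_range] at hi
        exact Finset.mem_Icc.mpr ⟨by omega, by omega⟩
      have := hK i hi'
      have := hM i hi'
      calc ‖d i (k + 1 - i)‖ ≤ M i * K i ^ (k + 1 - i) := hb i hi' _
        _ ≤ M i * K i ^ k := by
          gcongr
          omega
        _ ≤ M' * K' ^ k := by
          gcongr
          · exact hM1 i hi'
          · exact hK1 i hi'
  have hev : ∀ᶠ z in 𝓝[≠] ζ, ∀ i ∈ Finset.Icc 1 r,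
      (z - ζ) ^ i * a i z = seriesSum (c i) (z - ζ) := by
    rw [Finset.eventually_all]
    intro i hi
    have hi' := Finset.mem_Icc.mp hi
    have h1 : ∀ᶠ z in 𝓝[≠] ζ, z ∈ Metric.ball ζ K'⁻¹ :=
      nhdsWithin_le_nhds (Metric.ball_mem_nhds ζ (by positivity))
    filter_upwards [hd i hi, h1] with z hz hzK
    have hcv : ConvBound K'⁻¹ (c i) := convBound_of_geometric (by positivity)
      (hbound i (Finset.mem_range.mpr (by omega)))
    rw [hcv.seriesSum_eq_shift (i - 1) (fun n hn => by
      simp only [hc]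
      rw [if_neg (by omega), if_pos (by omega)]) (by simpa [dist_eq_norm] using hzK)]
    have h2 : (fun n => c i (n + (i - 1))) = d i := by
      funext n
      simp only [hc]
      rw [if_neg (by omega), if_neg (by omega)]
      congr 1
      omega
    rw [h2, ← hz, ← mul_assoc, ← pow_succ, Nat.sub_add_cancel hi'.1]
  have h1r : 1 ∈ Finset.Icc 1 r := Finset.mem_Icc.mpr ⟨le_rfl, hr⟩
  have hc1 : c 1 0 = δ := by
    have hcv : ConvBound K'⁻¹ (c 1) := convBound_of_geometric (by positivity)
      (hbound 1 (Finset.mem_range.mpr (by omega)))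
    have hcont : ContinuousAt (fun z => seriesSum (c 1) (z - ζ)) ζ := by
      have h0 : ContinuousAt (seriesSum (c 1)) (ζ - ζ) := by
        rw [sub_self]
        exact (hcv.hasDerivAt (by simpa using (by positivity : 0 < K'))).continuousAt
      exact h0.comp (f := fun z => z - ζ) (by fun_prop)
    have h2 : Tendsto (fun z => seriesSum (c 1) (z - ζ)) (𝓝[≠] ζ) (𝓝 (c 1 0)) := by
      have := hcont.tendsto.mono_left (nhdsWithin_le_nhds (s := {ζ}ᶜ))
      simpa [seriesSum_zero] using this
    refine tendsto_nhds_unique (h2.congr' ?_) hδ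
    filter_upwards [hev] with z hz
    rw [← hz 1 h1r, pow_one]
  refine ⟨c, M', K', by positivity, hbound, fun k => by simp [hc], fun i k hik => ?_, hc1, ?_, hev⟩
  · simp only [hc]
    rw [if_neg (by omega), if_pos hik]
  · rw [← hc1]
    simpa [hc] using hd0 1 h1r

/-! ### The solution space has dimension at most r -/

theorem lt_analyticOrderAt_sum {ι : Type*} (s : Finset ι) (f : ι → ℂ → ℂ) (z : ℂ) (m : ℕ)
    (h : ∀ i ∈ s, (m : ℕ∞) < analyticOrderAt (f i) z) :
    (m : ℕ∞) < analyticOrderAt (∑ i ∈ s, f i) z := by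
  classical
  induction s using Finset.induction_on with
  | empty =>
    have : analyticOrderAt (∑ i ∈ (∅ : Finset ι), f i) z = ⊤ := by
      rw [analyticOrderAt_eq_top]
      simp
    rw [this]
    exact ENat.natCast_lt_top m
  | insert i t hi ih =>
    rw [Finset.sum_insert hi]
    refine lt_of_lt_of_le (lt_min (h i (Finset.mem_insert_self _ _)) (ih fun j hj =>
      h j (Finset.mem_insert_of_mem hj))) le_analyticOrderAt_add

/-- Uniqueness in the initial value problem at a regular point. -/
theorem IsAnalyticSolutionOn.eqOn_zero {r : ℕ} (hr : 1 ≤ r) {a : ℕ → ℂ → ℂ} {S : Set ℂ}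
    (hS : IsOpen S) (hS' : IsPreconnected S) (ha : ∀ i ∈ Finset.Icc 1 r, AnalyticOnNhd ℂ (a i) S)
    {Y : ℂ → ℂ} (hY : IsAnalyticSolutionOn r a S Y) {z₀ : ℂ} (hz₀ : z₀ ∈ S)
    (h0 : ∀ j < r, iteratedDeriv j Y z₀ = 0) : Set.EqOn Y 0 S := by
  have hYz := hY.1 z₀ hz₀
  suffices htop : analyticOrderAt Y z₀ = ⊤ from
    hY.1.eqOn_zero_of_preconnected_of_eventuallyEq_zero hS' hz₀ (analyticOrderAt_eq_top.mp htop)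
  by_contra htop
  obtain ⟨N, hN⟩ := ENat.ne_top_iff_exists.mp htop
  have hrN : r ≤ N := by
    have := (natCast_le_analyticOrderAt_iff_iteratedDeriv_eq_zero hYz (n := r)).mpr h0
    rw [← hN] at this
    exact_mod_cast this
  -- If Y had finite order N ≥ r at z₀, its r-th derivative would have order N - r, while every
  -- other term of the equation has larger order. The terms could then not cancel.
  have hord : ∀ k ≤ r, analyticOrderAt (iteratedDeriv k Y) z₀ = (N - k : ℕ) := fun k hk => by
    rw [iteratedDeriv_eq_iterate]
    exact analyticOrderAt_iterated_deriv hYz hN (by omega) (by omega)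
  have hlt : ((N - r : ℕ) : ℕ∞) < analyticOrderAt
      (∑ i ∈ Finset.Icc 1 r, a i * iteratedDeriv (r - i) Y) z₀ := by
    refine lt_analyticOrderAt_sum _ _ _ _ fun i hi => ?_
    have hi' := Finset.mem_Icc.mp hi
    have hd : AnalyticAt ℂ (iteratedDeriv (r - i) Y) z₀ := by
      rw [iteratedDeriv_eq_iterate]
      exact hYz.iterated_deriv _
    rw [analyticOrderAt_mul (ha i hi z₀ hz₀) hd, hord _ (by omega)]
    refine lt_of_lt_of_le ?_ le_add_self
    exact_mod_cast (by omega : N - r < N - (r - i))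
  rw [← hord r le_rfl] at hlt
  have hsum := analyticOrderAt_add_eq_left_of_lt hlt
  have hzero : analyticOrderAt (iteratedDeriv r Y +
      ∑ i ∈ Finset.Icc 1 r, a i * iteratedDeriv (r - i) Y) z₀ = ⊤ := by
    rw [analyticOrderAt_eq_top]
    filter_upwards [hS.mem_nhds hz₀] with z hz
    have := hY.2 z hz
    simpa [odeOperator] using this
  rw [hzero, hord r le_rfl] at hsum
  exact ENat.natCast_ne_top _ hsum.symm

theorem IsAnalyticSolutionOn.congr {r : ℕ} {a : ℕ → ℂ → ℂ} {S : Set ℂ} (hS : IsOpen S)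
    {Y Z : ℂ → ℂ} (hY : IsAnalyticSolutionOn r a S Y) (h : Set.EqOn Y Z S) :
    IsAnalyticSolutionOn r a S Z := by
  have hev : ∀ z ∈ S, Y =ᶠ[𝓝 z] Z := fun z hz => h.eventuallyEq_of_mem (hS.mem_nhds hz)
  refine ⟨fun z hz => (hY.1 z hz).congr (hev z hz), fun z hz => ?_⟩
  rw [← hY.2 z hz, odeOperator, odeOperator]
  simp only [((hev z hz).iteratedDeriv _).eq_of_nhds]

open Classical in
/-- Extension of a function on `S` by zero. -/
noncomputable def extendByZero (S : Set ℂ) (y : S → ℂ) (z : ℂ) : ℂ :=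
  if h : z ∈ S then y ⟨z, h⟩ else 0

/-- Members of the solution space live on S only. Since S is open, their extension by zero has the
right derivatives on S and depends linearly on them, which makes the initial values a linear map. -/
theorem isAnalyticSolutionOn_extendByZero {r : ℕ} {a : ℕ → ℂ → ℂ} {S : Set ℂ} (hS : IsOpen S)
    (y : solutionSpace r a S) : IsAnalyticSolutionOn r a S (extendByZero S y) := by
  obtain ⟨Y, hY, hy⟩ := y.2
  refine hY.congr hS fun z hz => ?_
  simp only [extendByZero, dif_pos hz]
  exact (hy ⟨z, hz⟩).symm

/-- The initial values of a solution at a point. -/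
noncomputable def initialValues {r : ℕ} {a : ℕ → ℂ → ℂ} {S : Set ℂ} (hS : IsOpen S) {z₀ : ℂ}
    (hz₀ : z₀ ∈ S) : solutionSpace r a S →ₗ[ℂ] (Fin r → ℂ) where
  toFun y j := iteratedDeriv j (extendByZero S y) z₀
  map_add' y w := by
    funext j
    have h : extendByZero S (y + w : solutionSpace r a S) = extendByZero S y + extendByZero S w := by
      funext z
      by_cases hz : z ∈ S <;> simp [extendByZero, hz]
    rw [h, Pi.add_apply]
    exact iteratedDeriv_add ((isAnalyticSolutionOn_extendByZero hS y).1 z₀ hz₀).contDiffAt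
      ((isAnalyticSolutionOn_extendByZero hS w).1 z₀ hz₀).contDiffAt
  map_smul' c y := by
    funext j
    have h : extendByZero S (c • y : solutionSpace r a S) = c • extendByZero S y := by
      funext z
      by_cases hz : z ∈ S <;> simp [extendByZero, hz]
    rw [h, Pi.smul_apply]
    exact iteratedDeriv_const_smul ((isAnalyticSolutionOn_extendByZero hS y).1 z₀ hz₀).contDiffAt c

theorem initialValues_injective {r : ℕ} (hr : 1 ≤ r) {a : ℕ → ℂ → ℂ} {S : Set ℂ}
    (hS : IsOpen S) (hS' : IsPreconnected S) (ha : ∀ i ∈ Finset.Icc 1 r, AnalyticOnNhd ℂ (a i) S)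
    {z₀ : ℂ} (hz₀ : z₀ ∈ S) :
    Function.Injective (initialValues (r := r) (a := a) hS hz₀) := by
  rw [injective_iff_map_eq_zero]
  intro y hy
  have h := (isAnalyticSolutionOn_extendByZero hS y).eqOn_zero hr hS hS' ha hz₀
    fun j hj => congrFun hy ⟨j, hj⟩
  ext z
  have := h z.2
  simpa [extendByZero] using this

/-- Linearly independent solutions, as many as the order of the equation, form a basis. -/
theorem exists_basis_of_linearIndependent {r : ℕ} (hr : 1 ≤ r) {a : ℕ → ℂ → ℂ} {S : Set ℂ}
    (hS : IsOpen S) (hS' : IsPreconnected S) (hne : S.Nonempty)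
    (ha : ∀ i ∈ Finset.Icc 1 r, AnalyticOnNhd ℂ (a i) S) (v : Fin r → solutionSpace r a S)
    (hv : LinearIndependent ℂ v) :
    ∃ b : Module.Basis (Fin r) ℂ (solutionSpace r a S), ∀ i, b i = v i := by
  obtain ⟨z₀, hz₀⟩ := hne
  have hinj := initialValues_injective hr hS hS' ha hz₀
  have : Module.Finite ℂ (solutionSpace r a S) := Module.Finite.of_injective _ hinj
  have h1 := LinearMap.finrank_le_finrank_of_injective hinj
  have h2 := hv.fintype_card_le_finrank
  have : Nonempty (Fin r) := ⟨⟨0, hr⟩⟩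
  rw [Module.finrank_fin_fun] at h1
  refine ⟨basisOfLinearIndependentOfCardEqFinrank hv (le_antisymm h2 (by simpa using h1)),
    fun i => by simp⟩

/-! ### Growth along the bisecting ray and linear independence -/

/-- Functions of pairwise different growth are linearly independent. -/
theorem eq_zero_of_asymptotic_scale {ι : Type*} [Fintype ι] {F : Filter ℝ} {g : ι → ℝ → ℂ}
    {e : ι → ℝ} (he : Function.Injective e) (hg : ∀ i j, e i < e j → g j =o[F] g i)
    (hne : ∀ i, ∃ᶠ t in F, g i t ≠ 0) {c : ι → ℂ} (hc : ∀ᶠ t in F, ∑ i, c i * g i t = 0) :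
    ∀ i, c i = 0 := by
  classical
  by_contra! hcon
  obtain ⟨i₀, hi₀⟩ := hcon
  -- The smallest e belongs to the dominant function; the relation makes it negligible against
  -- itself.
  obtain ⟨i, hi, hmin⟩ := (Finset.univ.filter fun i => c i ≠ 0).exists_min_image e
    ⟨i₀, by simpa using hi₀⟩
  have hci : c i ≠ 0 := by simpa using hi
  refine Asymptotics.isLittleO_irrefl (hne i) ?_
  have h1 : (fun t => ∑ j ∈ Finset.univ.erase i, c j * g j t) =o[F] g i := by
    refine Asymptotics.IsLittleO.fun_sum fun j hj => ?_
    by_cases hcj : c j = 0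
    · simp only [hcj, zero_mul]
      exact Asymptotics.isLittleO_zero _ _
    · have hij : e i ≠ e j := fun h => (Finset.ne_of_mem_erase hj) (he h).symm
      exact (hg i j (lt_of_le_of_ne (hmin j (by simpa using hcj)) hij)).const_mul_left _
  refine (h1.const_mul_left (-(c i)⁻¹)).congr' ?_ EventuallyEq.rfl
  filter_upwards [hc] with t ht
  rw [← Finset.add_sum_erase _ _ (Finset.mem_univ i)] at ht
  rw [eq_neg_of_add_eq_zero_right ht]
  field_simp

theorem logBranch_ray (θ : ℝ) {t : ℝ} (ht : 0 < t) :
    logBranch θ (t * Complex.exp (θ * Complex.I)) = Real.log t + θ * Complex.I := by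
  rw [logBranch, mul_assoc, ← Complex.exp_add, add_neg_cancel, Complex.exp_zero, mul_one,
    Complex.ofReal_log ht.le]

theorem norm_powBranch_ray (θ l : ℝ) {t : ℝ} (ht : 0 < t) :
    ‖powBranch θ (t * Complex.exp (θ * Complex.I)) l‖ = t ^ l := by
  rw [powBranch, logBranch_ray θ ht, Complex.norm_exp, Real.rpow_def_of_pos ht]
  simp [mul_comm]

theorem tendsto_seriesSum_ray (θ : ℝ) {ρ : ℝ} (hρ : 0 < ρ) {c : ℕ → ℂ} (hc : ConvBound ρ c) :
    Tendsto (fun t : ℝ => seriesSum c (t * Complex.exp (θ * Complex.I))) (𝓝[>] 0) (𝓝 (c 0)) := by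
  have h0 : ContinuousAt (seriesSum c) 0 := (hc.hasDerivAt (by simpa using hρ)).continuousAt
  have h1 : Tendsto (fun t : ℝ => (t : ℂ) * Complex.exp (θ * Complex.I)) (𝓝[>] 0) (𝓝 0) := by
    have : Continuous fun t : ℝ => (t : ℂ) * Complex.exp (θ * Complex.I) := by fun_prop
    have := (this.tendsto 0).mono_left (nhdsWithin_le_nhds (s := Set.Ioi 0))
    simpa using this
  rw [← seriesSum_zero c]
  exact h0.tendsto.comp h1

theorem tendsto_mul_log_add_ray (a : ℂ) :
    Tendsto (fun t : ℝ => (t : ℂ) * (Real.log t + a)) (𝓝[>] 0) (𝓝 0) := by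
  have h1 : Tendsto (fun t : ℝ => ((Real.log t * t ^ (1 : ℝ) : ℝ) : ℂ)) (𝓝[>] 0) (𝓝 0) := by
    have := (Complex.continuous_ofReal.tendsto 0).comp (tendsto_log_mul_rpow_nhdsGT_zero one_pos)
    simpa [Function.comp_def] using this
  have h2 : Tendsto (fun t : ℝ => (t : ℂ) * a) (𝓝[>] 0) (𝓝 0) := by
    have : Continuous fun t : ℝ => (t : ℂ) * a := by fun_prop
    have := (this.tendsto 0).mono_left (nhdsWithin_le_nhds (s := Set.Ioi 0))
    simpa using this
  have := h1.add h2
  rw [add_zero] at this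
  refine this.congr fun t => ?_
  rw [Real.rpow_one]
  push_cast
  ring

theorem frobFun_ray (ζ : ℂ) (θ : ℝ) (l : ℂ) (h p : ℕ → ℂ) {t : ℝ} (ht : 0 < t) :
    frobFun ζ θ l h p (ζ + t * Complex.exp (θ * Complex.I)) =
      powBranch θ (t * Complex.exp (θ * Complex.I)) l *
        (seriesSum h (t * Complex.exp (θ * Complex.I)) +
          (Real.log t + θ * Complex.I) * seriesSum p (t * Complex.exp (θ * Complex.I))) := by
  rw [frobFun, add_sub_cancel_left, logBranch_ray θ ht]

/-- Along the bisecting ray, a solution without logarithm in its leading term grows like a power. -/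
theorem isTheta_frobFun_rpow (ζ : ℂ) (θ : ℝ) {ρ : ℝ} (hρ : 0 < ρ) (l : ℝ) {h p : ℕ → ℂ}
    (hh : ConvBound ρ h) (hp : ConvBound ρ p) (h0 : h 0 = 1) (p0 : p 0 = 0) :
    (fun t : ℝ => frobFun ζ θ l h p (ζ + t * Complex.exp (θ * Complex.I))) =Θ[𝓝[>] 0]
      fun t : ℝ => t ^ l := by
  have hB : Tendsto (fun t : ℝ => seriesSum h (t * Complex.exp (θ * Complex.I)) +
      (Real.log t + θ * Complex.I) * seriesSum p (t * Complex.exp (θ * Complex.I)))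
      (𝓝[>] 0) (𝓝 1) := by
    have h1 := tendsto_seriesSum_ray θ hρ hh
    -- Since p 0 = 0, the logarithm comes with a factor w, and t log t tends to 0.
    have h2 := ((tendsto_mul_log_add_ray (θ * Complex.I)).mul_const
      (Complex.exp (θ * Complex.I))).mul (tendsto_seriesSum_ray θ hρ (hp.shift 1))
    have h3 := h1.add h2
    rw [h0] at h3
    simp only [zero_mul, add_zero] at h3
    refine h3.congr' ?_
    filter_upwards [Ioo_mem_nhdsGT hρ] with t ht
    rw [hp.seriesSum_eq_shift 1 (fun n hn => by rw [Nat.lt_one_iff.mp hn, p0])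
      (w := t * Complex.exp (θ * Complex.I))
      (by simp [Complex.norm_exp_ofReal_mul_I, abs_of_pos ht.1, ht.2])]
    ring
  have hB' := (isTheta_of_div_tendsto_nhds_ne_zero (f := fun _ : ℝ => (1 : ℂ))
    (by simpa only [div_one] using hB) one_ne_zero).symm
  have hu : (fun t : ℝ => powBranch θ (t * Complex.exp (θ * Complex.I)) l) =Θ[𝓝[>] 0]
      fun t : ℝ => ((t ^ l : ℝ) : ℂ) := by
    refine IsTheta.of_norm_eventuallyEq_norm ?_
    filter_upwards [self_mem_nhdsWithin] with t ht
    have ht : 0 < t := ht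
    rw [norm_powBranch_ray θ l ht, Complex.norm_real, Real.norm_of_nonneg (by positivity)]
  refine IsTheta.trans (g := fun t : ℝ => ((t ^ l : ℝ) : ℂ)) ?_ ?_
  · have h1 := hu.mul hB'
    simp only [mul_one] at h1
    refine EventuallyEq.trans_isTheta ?_ h1
    filter_upwards [self_mem_nhdsWithin] with t ht
    exact frobFun_ray ζ θ l h p ht
  · exact IsTheta.of_norm_eventuallyEq_norm (Eventually.of_forall fun t => Complex.norm_real _)

/-- Along the bisecting ray, a solution with logarithm in its leading term grows like a power
times a logarithm. -/
theorem isTheta_frobFun_rpow_mul_log (ζ : ℂ) (θ : ℝ) {ρ : ℝ} (hρ : 0 < ρ) (l : ℝ) {h p : ℕ → ℂ}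
    (hh : ConvBound ρ h) (hp : ConvBound ρ p) (p0 : p 0 = 1) :
    (fun t : ℝ => frobFun ζ θ l h p (ζ + t * Complex.exp (θ * Complex.I))) =Θ[𝓝[>] 0]
      fun t : ℝ => t ^ l * Real.log t := by
  have hlog : Tendsto (fun t : ℝ => ((Real.log t)⁻¹ : ℂ)) (𝓝[>] 0) (𝓝 0) := by
    have h1 : Tendsto Real.log (𝓝[>] 0) atBot :=
      Real.tendsto_log_nhdsNE_zero.mono_left (nhdsWithin_mono _ fun _ h => ne_of_gt h)
    have := (Complex.continuous_ofReal.tendsto 0).comp h1.inv_tendsto_atBot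
    simpa [Function.comp_def] using this
  have hlt : ∀ᶠ t : ℝ in 𝓝[>] 0, Real.log t ≠ 0 := by
    filter_upwards [Ioo_mem_nhdsGT one_pos] with t ht
    exact (Real.log_neg ht.1 ht.2).ne
  have hB : Tendsto (fun t : ℝ => (seriesSum h (t * Complex.exp (θ * Complex.I)) +
      (Real.log t + θ * Complex.I) * seriesSum p (t * Complex.exp (θ * Complex.I))) /
      (Real.log t : ℂ)) (𝓝[>] 0) (𝓝 1) := by
    have h1 := (tendsto_seriesSum_ray θ hρ hh).mul hlog
    have h2 := ((hlog.const_mul (θ * Complex.I)).const_add 1).mul (tendsto_seriesSum_ray θ hρ hp)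
    have h3 := h1.add h2
    rw [p0] at h3
    simp only [mul_zero, add_zero, mul_one, zero_add] at h3
    refine h3.congr' ?_
    filter_upwards [hlt] with t ht
    have : (Real.log t : ℂ) ≠ 0 := by exact_mod_cast ht
    field_simp
  have hB' := (isTheta_of_div_tendsto_nhds_ne_zero hB one_ne_zero).symm
  have hu : (fun t : ℝ => powBranch θ (t * Complex.exp (θ * Complex.I)) l) =Θ[𝓝[>] 0]
      fun t : ℝ => ((t ^ l : ℝ) : ℂ) := by
    refine IsTheta.of_norm_eventuallyEq_norm ?_
    filter_upwards [self_mem_nhdsWithin] with t ht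
    have ht : 0 < t := ht
    rw [norm_powBranch_ray θ l ht, Complex.norm_real, Real.norm_of_nonneg (by positivity)]
  refine IsTheta.trans (g := fun t : ℝ => ((t ^ l : ℝ) : ℂ) * (Real.log t : ℂ)) ?_ ?_
  · refine EventuallyEq.trans_isTheta ?_ (hu.mul hB')
    filter_upwards [self_mem_nhdsWithin] with t ht
    exact frobFun_ray ζ θ l h p ht
  · refine IsTheta.of_norm_eventuallyEq_norm (Eventually.of_forall fun t => ?_)
    beta_reduce
    rw [norm_mul, norm_mul, Complex.norm_real, Complex.norm_real]

theorem isLittleO_rpow_rpow_nhdsGT_zero {a b : ℝ} (h : b < a) :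
    (fun t : ℝ => t ^ a) =o[𝓝[>] 0] fun t : ℝ => t ^ b := by
  rw [isLittleO_iff_tendsto']
  · have : Tendsto (fun t : ℝ => t ^ (a - b)) (𝓝[>] 0) (𝓝 0) := by
      have hc := (Real.continuousAt_rpow_const 0 (a - b) (Or.inr (by linarith))).tendsto
      rw [Real.zero_rpow (by linarith)] at hc
      exact hc.mono_left nhdsWithin_le_nhds
    refine this.congr' ?_
    filter_upwards [self_mem_nhdsWithin] with t ht
    exact Real.rpow_sub ht _ _
  · filter_upwards [self_mem_nhdsWithin] with t ht h0
    exact absurd h0 (Real.rpow_pos_of_pos ht _).ne'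

theorem isLittleO_rpow_mul_log_rpow {a b : ℝ} (h : b < a) :
    (fun t : ℝ => t ^ a * Real.log t) =o[𝓝[>] 0] fun t : ℝ => t ^ b := by
  rw [isLittleO_iff_tendsto']
  · refine (tendsto_log_mul_rpow_nhdsGT_zero (sub_pos.mpr h)).congr' ?_
    filter_upwards [self_mem_nhdsWithin] with t ht
    rw [Real.rpow_sub ht]
    ring
  · filter_upwards [self_mem_nhdsWithin] with t ht h0
    exact absurd h0 (Real.rpow_pos_of_pos ht _).ne'

theorem isLittleO_rpow_rpow_mul_log {a b : ℝ} (h : b ≤ a) :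
    (fun t : ℝ => t ^ a) =o[𝓝[>] 0] fun t : ℝ => t ^ b * Real.log t := by
  have h1 : (fun t : ℝ => t ^ a) =O[𝓝[>] 0] fun t : ℝ => t ^ b := by
    rcases h.eq_or_lt with rfl | h
    · exact isBigO_refl _ _
    · exact (isLittleO_rpow_rpow_nhdsGT_zero h).isBigO
  have h2 : (fun _ : ℝ => (1 : ℝ)) =o[𝓝[>] 0] Real.log := by
    rw [isLittleO_const_left]
    right
    have h1 : Tendsto Real.log (𝓝[>] 0) atBot :=
      Real.tendsto_log_nhdsNE_zero.mono_left (nhdsWithin_mono _ fun _ h => ne_of_gt h)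
    exact tendsto_abs_atBot_atTop.comp h1
  simpa using h1.mul_isLittleO h2

theorem IsTheta.frequently_ne_zero {F : Filter ℝ} [F.NeBot] {f : ℝ → ℂ} {g : ℝ → ℝ} (h : f =Θ[F] g)
    (hg : ∀ᶠ t in F, g t ≠ 0) : ∃ᶠ t in F, f t ≠ 0 := by
  refine Eventually.frequently ?_
  filter_upwards [h.2.eq_zero_imp, hg] with t ht hgt hf
  exact hgt (ht hf)

/-- Linear independence of functions with the growth of the monomials of degree less than `s`
and of one further function whose growth lies strictly between that of two monomials. -/
theorem eq_zero_of_growth {s : ℕ} {g : Fin (s + 1) → ℝ → ℂ}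
    (hreg : ∀ i : Fin (s + 1), (i : ℕ) < s → g i =Θ[𝓝[>] 0] fun t : ℝ => t ^ ((i : ℕ) : ℝ)) {e : ℝ}
    (he : ∀ m : ℕ, m < s → e ≠ m)
    (hlt : ∀ m : ℕ, m < s → m < e → g (Fin.last s) =o[𝓝[>] 0] fun t : ℝ => t ^ (m : ℝ))
    (hgt : ∀ m : ℕ, m < s → e < m → (fun t : ℝ => t ^ (m : ℝ)) =o[𝓝[>] 0] g (Fin.last s))
    (hne : ∃ᶠ t in 𝓝[>] 0, g (Fin.last s) t ≠ 0) {c : Fin (s + 1) → ℂ}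
    (hc : ∀ᶠ t in 𝓝[>] 0, ∑ i, c i * g i t = 0) : ∀ i, c i = 0 := by
  have hcases : ∀ i : Fin (s + 1), i = Fin.last s ∨ (i : ℕ) < s := fun i => by
    rcases Nat.lt_succ_iff_lt_or_eq.mp i.2 with h | h
    · exact Or.inr h
    · exact Or.inl (Fin.ext h)
  have hlast : ∀ i : Fin (s + 1), (i : ℕ) < s → i ≠ Fin.last s := by
    rintro i hi rfl
    simp at hi
  -- The number e only records the place of the last function among the monomials; that function
  -- need not be comparable to t^e.
  set E : Fin (s + 1) → ℝ := fun i => if i = Fin.last s then e else (i : ℕ) with hE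
  have hE1 : E (Fin.last s) = e := if_pos rfl
  have hE2 : ∀ i : Fin (s + 1), (i : ℕ) < s → E i = (i : ℕ) := fun i hi => if_neg (hlast i hi)
  refine eq_zero_of_asymptotic_scale (e := E) ?_ ?_ ?_ hc
  · intro i j hij
    rcases hcases i with rfl | hi <;> rcases hcases j with rfl | hj
    · rfl
    · rw [hE1, hE2 j hj] at hij
      exact absurd hij (he j hj)
    · rw [hE1, hE2 i hi] at hij
      exact absurd hij.symm (he i hi)
    · rw [hE2 i hi, hE2 j hj] at hij
      exact Fin.ext (by exact_mod_cast hij)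
  · intro i j hij
    rcases hcases i with rfl | hi <;> rcases hcases j with rfl | hj
    · exact absurd hij (lt_irrefl _)
    · rw [hE1, hE2 j hj] at hij
      exact (hreg j hj).trans_isLittleO (hgt j hj hij)
    · rw [hE1, hE2 i hi] at hij
      exact (hlt i hi hij).trans_isTheta (hreg i hi).symm
    · rw [hE2 i hi, hE2 j hj] at hij
      exact ((hreg j hj).trans_isLittleO (isLittleO_rpow_rpow_nhdsGT_zero hij)).trans_isTheta
        (hreg i hi).symm
  · intro i
    rcases hcases i with rfl | hi
    · exact hne
    · refine IsTheta.frequently_ne_zero (hreg i hi) ?_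
      filter_upwards [self_mem_nhdsWithin] with t ht
      exact (Real.rpow_pos_of_pos ht _).ne'

/-! ### Frobenius solutions and the basis -/

/-- The equations between coefficients which say that `frobFun ζ θ l h p` is a solution. -/
def IsFrobeniusPair (r : ℕ) (c : ℕ → ℕ → ℂ) (l : ℂ) (h p : ℕ → ℂ) : Prop :=
  (∀ k, ∑ j ∈ Finset.range (k + 1), (frobPoly r c (k - j)).eval (l + j) * p j = 0) ∧
  (∀ k, ∑ j ∈ Finset.range (k + 1), ((frobPoly r c (k - j)).eval (l + j) * h j +
    (frobPoly r c (k - j)).derivative.eval (l + j) * p j) = 0)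

theorem convBound_zero (ρ : ℝ) : ConvBound ρ 0 := fun _ _ _ => ⟨0, fun n => by simp⟩

theorem IsFrobeniusPair.of_log_free {r : ℕ} {c : ℕ → ℕ → ℂ} {l : ℂ} {h : ℕ → ℂ}
    (hh : ∀ k, ∑ j ∈ Finset.range (k + 1), (frobPoly r c (k - j)).eval (l + j) * h j = 0) :
    IsFrobeniusPair r c l h 0 := ⟨fun k => by simp, fun k => by simpa using hh k⟩

/-- As δ > 0, even the root s - δ lies below s. Every resonance thus has m + k < s, where the
polynomials entering the obstruction vanish. -/
theorem exists_regular_pair {s : ℕ} {c : ℕ → ℕ → ℂ} {M K : ℝ} (hK : 0 < K)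
    (hc : ∀ i ∈ Finset.range (s + 1 + 1), ∀ k, ‖c i k‖ ≤ M * K ^ k) (hc0 : c 0 0 = 1)
    (hcv : ∀ i k, k + 1 < i → c i k = 0) {δ : ℝ} (hδ : 0 < δ) (hc1 : c 1 0 = δ) {m : ℕ}
    (hm : m < s) :
    ∃ (h : ℕ → ℂ) (ρ : ℝ), 0 < ρ ∧ ConvBound ρ h ∧ h 0 = 1 ∧
      IsFrobeniusPair (s + 1) c m h 0 := by
  obtain ⟨h, h0, ⟨ρ, hρ, hh⟩, hE⟩ := exists_log_free_coefficients (l := m) hK hc hc0 hcv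
    (by rw [frobPoly_zero_eval hc0 hcv, (descPochhammer_eval_eq_zero_iff _ _).mpr ⟨m, hm, rfl⟩,
      zero_mul])
    (fun k _ hzero j hj => by
      have hmk : m + k < s := by
        rw [frobPoly_zero_eval hc0 hcv, hc1, mul_eq_zero, descPochhammer_eval_eq_zero_iff] at hzero
        rcases hzero with ⟨i, hi, h⟩ | h
        · have : m + k = i := by exact_mod_cast h
          omega
        · have h1 : ((m : ℝ) + k - (s - δ) : ℝ) = 0 := by exact_mod_cast h
          have h2 : (m : ℝ) + k < s := by linarith
          exact_mod_cast h2
      rw [← Nat.cast_add]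
      exact frobPoly_eval_natCast_eq_zero hcv (by omega))
  exact ⟨h, ρ, hρ, hh, h0, .of_log_free hE⟩

theorem exists_last_pair {s : ℕ} {c : ℕ → ℕ → ℂ} {M K : ℝ} (hK : 0 < K)
    (hc : ∀ i ∈ Finset.range (s + 1 + 1), ∀ k, ‖c i k‖ ≤ M * K ^ k) (hc0 : c 0 0 = 1)
    (hcv : ∀ i k, k + 1 < i → c i k = 0) {δ : ℝ} (hδ : 0 < δ) (hc1 : c 1 0 = δ) :
    ∃ (h p : ℕ → ℂ) (ρ : ℝ), 0 < ρ ∧ ConvBound ρ h ∧ ConvBound ρ p ∧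
      IsFrobeniusPair (s + 1) c ((s : ℂ) - δ) h p ∧
      ((∃ n : ℕ, n ≤ s ∧ 1 ≤ n ∧ δ = n ∧ p 0 = 1 ∧ ∀ k < n, h k = 0) ∨
        (∃ n : ℕ, s < n ∧ δ = n ∧ h 0 = 1 ∧ ∀ k, k + s < n → p k = 0) ∨
        ((¬∃ n : ℤ, δ = n) ∧ h 0 = 1 ∧ p = 0)) := by
  by_cases hint : ∃ n : ℤ, δ = n
  · obtain ⟨n', hn'⟩ := hint
    have hn0 : 0 < n' := by
      rw [hn'] at hδ
      exact_mod_cast hδ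
    lift n' to ℕ using hn0.le with n
    have hδn : δ = n := by simpa using hn'
    have hn : 1 ≤ n := by omega
    have hδn' : (δ : ℂ) = n := by rw [hδn]; simp
    rw [hδn'] at hc1 ⊢
    rcases le_or_gt n s with hns | hns
    · obtain ⟨h, p, hh0, hp0, ⟨ρ, hρ, hh, hp⟩, -, hz, E1, E2⟩ :=
        exists_resonant_coefficients (h₀ := 0) (p₀ := 1) hK hc hc0 hcv hn hc1 (by omega)
      -- For n ≤ s every k with 1 ≤ k < n is resonant, so h k was set to 0 there; with h 0 = 0 the
      -- log-free part starts at w^s.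
      refine ⟨h, p, ρ, hρ, hh, hp, ⟨E1, E2⟩, Or.inl ⟨n, hns, hn, hδn, hp0, fun k hk => ?_⟩⟩
      rcases Nat.eq_zero_or_pos k with rfl | hk0
      · exact hh0
      · exact hz k hk0 hk (by omega)
    · obtain ⟨h, p, hh0, hp0, ⟨ρ, hρ, hh, hp⟩, hz, -, E1, E2⟩ :=
        exists_resonant_coefficients (h₀ := 1) (p₀ := 0) hK hc hc0 hcv hn hc1 (by simp)
      exact ⟨h, p, ρ, hρ, hh, hp, ⟨E1, E2⟩, Or.inr (Or.inl ⟨n, hns, hδn, hh0, hz⟩)⟩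
  · obtain ⟨h, h0, ⟨ρ, hρ, hh⟩, hE⟩ := exists_log_free_coefficients (l := (s : ℂ) - δ) hK hc hc0
      hcv (by rw [frobPoly_zero_eval hc0 hcv, hc1, sub_self, mul_zero])
      (fun k hk hzero => by
        rw [frobPoly_zero_eval hc0 hcv, hc1, add_sub_cancel_left, mul_eq_zero,
          descPochhammer_eval_eq_zero_iff] at hzero
        rcases hzero with ⟨i, hi, h⟩ | h
        · have h1 : ((s : ℝ) - δ + k : ℝ) = i := by exact_mod_cast h
          refine absurd ⟨(s : ℤ) + k - i, ?_⟩ hint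
          push_cast
          linarith
        · have : k = 0 := by exact_mod_cast h
          omega)
    exact ⟨h, 0, ρ, hρ, hh, convBound_zero ρ, .of_log_free hE, Or.inr (Or.inr ⟨hint, h0, rfl⟩)⟩

theorem exists_pos_le_forall_lt (s : ℕ) {ρ : ℕ → ℝ} (hρ : ∀ m < s, 0 < ρ m) :
    ∃ R : ℝ, 0 < R ∧ ∀ m < s, R ≤ ρ m := by
  induction s with
  | zero => exact ⟨1, one_pos, by simp⟩
  | succ s ih =>
    obtain ⟨R, hR, h⟩ := ih fun m hm => hρ m (by omega)
    refine ⟨min R (ρ s), lt_min hR (hρ s (by omega)), fun m hm => ?_⟩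
    rcases Nat.lt_succ_iff_lt_or_eq.mp hm with hm | rfl
    · exact (min_le_left _ _).trans (h m hm)
    · exact min_le_right _ _

theorem seriesSum_zero_fun (w : ℂ) : seriesSum 0 w = 0 := by simp [seriesSum]

theorem analyticOnNhd_of_pow_mul_eq_seriesSum {ζ : ℂ} {θ ρ : ℝ} {f : ℂ → ℂ} {i : ℕ} {c : ℕ → ℂ}
    (hc : ConvBound ρ c)
    (h : ∀ z ≠ ζ, ‖z - ζ‖ < ρ → (z - ζ) ^ i * f z = seriesSum c (z - ζ)) :
    AnalyticOnNhd ℂ f (slitDisc ζ θ ρ) := by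
  intro z hz
  have hw0 := sub_ne_zero_of_mem_slitDisc hz
  have h1 : AnalyticAt ℂ (fun z => seriesSum c (z - ζ)) z :=
    (hc.analyticOnNhd (z - ζ) (by simpa using norm_sub_lt_of_mem_slitDisc hz)).fun_comp
      (g := seriesSum c) (f := fun z => z - ζ) (by fun_prop)
  have h2 : AnalyticAt ℂ (fun z => seriesSum c (z - ζ) / (z - ζ) ^ i) z :=
    h1.div (by fun_prop) (pow_ne_zero _ hw0)
  refine h2.congr ?_
  filter_upwards [(isOpen_slitDisc ζ θ ρ).mem_nhds hz] with y hy
  have hy0 := sub_ne_zero_of_mem_slitDisc hy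
  rw [← h y (sub_ne_zero.mp hy0) (norm_sub_lt_of_mem_slitDisc hy)]
  field_simp

/-- Growth of the last solution along the bisecting ray, compared with the monomials. -/
theorem exists_growth_of_last_pair {s : ℕ} {δ : ℝ} {ζ : ℂ} {θ ρ : ℝ} (hρ : 0 < ρ) {h p : ℕ → ℂ}
    (hh : ConvBound ρ h) (hp : ConvBound ρ p)
    (hcases : (∃ n : ℕ, n ≤ s ∧ 1 ≤ n ∧ δ = n ∧ p 0 = 1 ∧ ∀ k < n, h k = 0) ∨
        (∃ n : ℕ, s < n ∧ δ = n ∧ h 0 = 1 ∧ ∀ k, k + s < n → p k = 0) ∨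
        ((¬∃ n : ℤ, δ = n) ∧ h 0 = 1 ∧ p = 0)) :
    ∃ e : ℝ, (∀ m : ℕ, m < s → e ≠ m) ∧
      (∀ m : ℕ, m < s → m < e → (fun t : ℝ => frobFun ζ θ ((s : ℂ) - δ) h p
        (ζ + t * Complex.exp (θ * Complex.I))) =o[𝓝[>] 0] fun t : ℝ => t ^ (m : ℝ)) ∧
      (∀ m : ℕ, m < s → e < m → (fun t : ℝ => t ^ (m : ℝ)) =o[𝓝[>] 0] fun t : ℝ =>
        frobFun ζ θ ((s : ℂ) - δ) h p (ζ + t * Complex.exp (θ * Complex.I))) ∧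
      ∃ᶠ t : ℝ in 𝓝[>] 0,
        frobFun ζ θ ((s : ℂ) - δ) h p (ζ + t * Complex.exp (θ * Complex.I)) ≠ 0 := by
  have hcast : (s : ℂ) - δ = ((s - δ : ℝ) : ℂ) := by push_cast; rfl
  rw [hcast]
  have hrpow : ∀ᶠ t : ℝ in 𝓝[>] 0, t ^ (s - δ : ℝ) ≠ 0 := by
    filter_upwards [self_mem_nhdsWithin] with t ht
    exact (Real.rpow_pos_of_pos ht _).ne'
  have hmain : h 0 = 1 → p 0 = 0 → (∀ m : ℕ, m < s → (s - δ : ℝ) ≠ m) →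
      ∃ e : ℝ, (∀ m : ℕ, m < s → e ≠ m) ∧
      (∀ m : ℕ, m < s → m < e → (fun t : ℝ => frobFun ζ θ ((s - δ : ℝ) : ℂ) h p
        (ζ + t * Complex.exp (θ * Complex.I))) =o[𝓝[>] 0] fun t : ℝ => t ^ (m : ℝ)) ∧
      (∀ m : ℕ, m < s → e < m → (fun t : ℝ => t ^ (m : ℝ)) =o[𝓝[>] 0] fun t : ℝ =>
        frobFun ζ θ ((s - δ : ℝ) : ℂ) h p (ζ + t * Complex.exp (θ * Complex.I))) ∧
      ∃ᶠ t : ℝ in 𝓝[>] 0,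
        frobFun ζ θ ((s - δ : ℝ) : ℂ) h p (ζ + t * Complex.exp (θ * Complex.I)) ≠ 0 := by
    intro h0 p0 hne
    have hΘ := isTheta_frobFun_rpow ζ θ hρ (s - δ) hh hp h0 p0
    exact ⟨s - δ, hne, fun m _ hm => hΘ.trans_isLittleO (isLittleO_rpow_rpow_nhdsGT_zero hm),
      fun m _ hm => (isLittleO_rpow_rpow_nhdsGT_zero hm).trans_isTheta hΘ.symm,
      IsTheta.frequently_ne_zero hΘ hrpow⟩
  rcases hcases with ⟨n, hns, hn, hδn, p0, -⟩ | ⟨n, hns, hδn, h0, hpz⟩ | ⟨hint, h0, hp0⟩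
  · have hΘ := isTheta_frobFun_rpow_mul_log ζ θ hρ (s - δ) hh hp p0
    have hsn : (s - δ : ℝ) = ((s - n : ℕ) : ℝ) := by rw [hδn, Nat.cast_sub hns]
    -- The function t^(s-n) log t lies strictly between t^(s-n-1) and t^(s-n), hence a half-integer
    -- as its place.
    refine ⟨s - δ - 1 / 2, fun m _ hm => ?_, fun m _ hm => ?_, fun m _ hm => ?_, ?_⟩
    · rw [hsn] at hm
      have h1 : (2 * (s - n : ℕ) : ℝ) = 2 * m + 1 := by linarith
      have h2 : 2 * (s - n) = 2 * m + 1 := by exact_mod_cast h1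
      omega
    · exact hΘ.trans_isLittleO (isLittleO_rpow_mul_log_rpow (by linarith))
    · refine (isLittleO_rpow_rpow_mul_log ?_).trans_isTheta hΘ.symm
      rw [hsn] at hm ⊢
      have h1 : ((s - n : ℕ) : ℝ) < (m + 1 : ℕ) := by push_cast; linarith
      have h2 : s - n < m + 1 := by exact_mod_cast h1
      exact_mod_cast Nat.lt_succ_iff.mp h2
    · refine IsTheta.frequently_ne_zero hΘ ?_
      filter_upwards [hrpow, Ioo_mem_nhdsGT one_pos] with t ht ht1
      exact mul_ne_zero ht (Real.log_neg ht1.1 ht1.2).ne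
  · refine hmain h0 (hpz 0 (by omega)) fun m _ hm => ?_
    have h1 : (s : ℝ) < n := by exact_mod_cast hns
    have h2 : (0 : ℝ) ≤ m := Nat.cast_nonneg m
    rw [hδn] at hm
    linarith
  · refine hmain h0 (by rw [hp0]; rfl) fun m _ hm => hint ⟨(s : ℤ) - m, ?_⟩
    push_cast
    linarith

theorem IsFrobeniusPair.isAnalyticSolutionOn {r : ℕ} {a : ℕ → ℂ → ℂ} {ζ : ℂ} {θ ρ : ℝ}
    {c : ℕ → ℕ → ℂ} {l : ℂ} {h p : ℕ → ℂ} (hF : IsFrobeniusPair r c l h p)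
    (hc : ∀ i ∈ Finset.range (r + 1), ConvBound ρ (c i))
    (hc0 : ∀ k, c 0 k = if k = 0 then 1 else 0)
    (ha : ∀ i ∈ Finset.Icc 1 r, ∀ z ≠ ζ, ‖z - ζ‖ < ρ →
      (z - ζ) ^ i * a i z = seriesSum (c i) (z - ζ))
    (hh : ConvBound ρ h) (hp : ConvBound ρ p) :
    IsAnalyticSolutionOn r a (slitDisc ζ θ ρ) (frobFun ζ θ l h p) :=
  isAnalyticSolutionOn_frobFun hc hc0 ha hh hp hF.1 hF.2

theorem frobFun_log_free (ζ : ℂ) (θ : ℝ) (l : ℂ) (h : ℕ → ℂ) (z : ℂ) :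
    frobFun ζ θ l h 0 z = powBranch θ (z - ζ) l * seriesSum h (z - ζ) := by
  rw [frobFun, seriesSum_zero_fun, mul_zero, add_zero]

theorem exists_frobenius_basis {s : ℕ} {a : ℕ → ℂ → ℂ} {ζ : ℂ} {θ ρ : ℝ} (hρ : 0 < ρ)
    {c : ℕ → ℕ → ℂ} {δ : ℝ} {h p : ℕ → ℂ} {g : ℕ → ℕ → ℂ}
    (hc : ∀ i ∈ Finset.range (s + 1 + 1), ConvBound ρ (c i))
    (hc0 : ∀ k, c 0 k = if k = 0 then 1 else 0)
    (ha : ∀ i ∈ Finset.Icc 1 (s + 1), ∀ z ≠ ζ, ‖z - ζ‖ < ρ →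
      (z - ζ) ^ i * a i z = seriesSum (c i) (z - ζ))
    (hg : ∀ m < s, ConvBound ρ (g m) ∧ g m 0 = 1 ∧ IsFrobeniusPair (s + 1) c m (g m) 0)
    (hh : ConvBound ρ h) (hp : ConvBound ρ p) (hF : IsFrobeniusPair (s + 1) c ((s : ℂ) - δ) h p)
    (hcases : (∃ n : ℕ, n ≤ s ∧ 1 ≤ n ∧ δ = n ∧ p 0 = 1 ∧ ∀ k < n, h k = 0) ∨
        (∃ n : ℕ, s < n ∧ δ = n ∧ h 0 = 1 ∧ ∀ k, k + s < n → p k = 0) ∨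
        ((¬∃ n : ℤ, δ = n) ∧ h 0 = 1 ∧ p = 0)) :
    ∃ b : Module.Basis (Fin (s + 1)) ℂ (solutionSpace (s + 1) a (slitDisc ζ θ ρ)),
      (∀ m : Fin (s + 1), (m : ℕ) < s → ∀ z : slitDisc ζ θ ρ,
        (b m : slitDisc ζ θ ρ → ℂ) z = frobFun ζ θ ((m : ℕ) : ℂ) (g m) 0 z) ∧
      ∀ z : slitDisc ζ θ ρ, (b (Fin.last s) : slitDisc ζ θ ρ → ℂ) z =
        frobFun ζ θ ((s : ℂ) - δ) h p z := by
  set F : Fin (s + 1) → ℂ → ℂ := fun i =>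
    if (i : ℕ) < s then frobFun ζ θ ((i : ℕ) : ℂ) (g i) 0 else frobFun ζ θ ((s : ℂ) - δ) h p
    with hFdef
  have hF1 : ∀ i : Fin (s + 1), (i : ℕ) < s → F i = frobFun ζ θ ((i : ℕ) : ℂ) (g i) 0 :=
    fun i hi => if_pos hi
  have hF2 : F (Fin.last s) = frobFun ζ θ ((s : ℂ) - δ) h p := if_neg (by simp)
  have hsol : ∀ i, IsAnalyticSolutionOn (s + 1) a (slitDisc ζ θ ρ) (F i) := by
    intro i
    simp only [hFdef]
    split_ifs with hi
    · exact (hg i hi).2.2.isAnalyticSolutionOn hc hc0 ha (hg i hi).1 (convBound_zero ρ)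
    · exact hF.isAnalyticSolutionOn hc hc0 ha hh hp
  set v : Fin (s + 1) → solutionSpace (s + 1) a (slitDisc ζ θ ρ) :=
    fun i => ⟨fun z => F i z, F i, hsol i, fun _ => rfl⟩ with hv
  have hli : LinearIndependent ℂ v := by
    rw [Fintype.linearIndependent_iff]
    intro d hd
    obtain ⟨e, he, hlt, hgt, hne⟩ :=
      exists_growth_of_last_pair (ζ := ζ) (θ := θ) hρ hh hp hcases
    refine eq_zero_of_growth (g := fun i (t : ℝ) => F i (ζ + t * Complex.exp (θ * Complex.I)))
      ?_ he (by simpa only [hF2] using hlt) (by simpa only [hF2] using hgt)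
      (by simpa only [hF2] using hne) ?_
    · intro i hi
      simp only [hF1 i hi]
      simpa using isTheta_frobFun_rpow ζ θ hρ ((i : ℕ) : ℝ) (hg i hi).1 (convBound_zero ρ)
        (hg i hi).2.1 rfl
    · filter_upwards [Ioo_mem_nhdsGT hρ] with t ht
      have h1 := congrFun (congrArg Subtype.val hd) ⟨_, ray_mem_slitDisc ζ θ ht.1 ht.2⟩
      simpa [hv] using h1
  obtain ⟨b, hb⟩ := exists_basis_of_linearIndependent (by omega) (isOpen_slitDisc ζ θ ρ)
    (isPreconnected_slitDisc ζ θ ρ)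
    ⟨_, ray_mem_slitDisc ζ θ (half_pos hρ) (half_lt_self hρ)⟩
    (fun i hi => analyticOnNhd_of_pow_mul_eq_seriesSum
      (hc i (Finset.mem_range.mpr (by have := (Finset.mem_Icc.mp hi).2; omega))) (ha i hi)) v hli
  refine ⟨b, fun m hm z => ?_, fun z => ?_⟩
  · rw [hb, ← hF1 m hm]
  · rw [hb, ← hF2]

theorem powBranch_sub_natCast_mul_pow (θ : ℝ) {w : ℂ} (hw : w ≠ 0) (s n : ℕ) :
    powBranch θ w ((s : ℂ) - n) * w ^ n = w ^ s := by
  rw [powBranch_sub_natCast θ hw, powBranch_natCast θ hw, mul_assoc,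
    inv_mul_cancel₀ (pow_ne_zero _ hw), mul_one]

theorem powBranch_sub_natCast_mul_pow_sub (θ : ℝ) {w : ℂ} (hw : w ≠ 0) {s n : ℕ} (h : s ≤ n) :
    powBranch θ w ((s : ℂ) - n) * w ^ (n - s) = 1 := by
  rw [powBranch_sub_natCast θ hw, powBranch_natCast θ hw]
  have : w ^ n = w ^ s * w ^ (n - s) := by rw [← pow_add, Nat.add_sub_cancel' h]
  rw [this]
  have := pow_ne_zero s hw
  have := pow_ne_zero (n - s) hw
  field_simp

theorem theorem7p10 (r : ℕ) (hr : 1 ≤ r) (Ω : Set ℂ) (hΩ : IsOpen Ω) (ζ : ℂ) (hζ : ζ ∈ Ω)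
    (a : ℕ → ℂ → ℂ) (ha : ∀ i ∈ Finset.Icc 1 r, MeromorphicOn (a i) Ω)
    (hreg : IsRegularSingularPoint r a ζ)
    (hpole : ∀ i ∈ Finset.Icc 1 r, poleOrder (a i) ζ = 1)
    (δ : ℝ) (hδ : Filter.Tendsto (fun z => (z - ζ) * a 1 z) (nhdsWithin ζ {ζ}ᶜ) (nhds (δ : ℂ)))
    (hδ0 : 0 ≤ δ) :
    ∃ R : ℝ, 0 < R ∧ Metric.ball ζ R ⊆ Ω ∧
      ∀ (θ ρ : ℝ), 0 < ρ → ρ ≤ R →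
        ∃ b : Module.Basis (Fin r) ℂ (solutionSpace r a (slitDisc ζ θ ρ)),
          -- the first `r - 1` basis functions
          (∀ m : Fin r, (m : ℕ) + 1 < r →
            ∃ H : ℂ → ℂ, AnalyticOnNhd ℂ H (Metric.ball 0 ρ) ∧ H 0 ≠ 0 ∧
              ∀ z : slitDisc ζ θ ρ, (b m : slitDisc ζ θ ρ → ℂ) z =
                ((z : ℂ) - ζ) ^ (m : ℕ) * H (z - ζ)) ∧
          -- the last basis function
          (∀ l : Fin r, (l : ℕ) + 1 = r →
            ∃ H : ℂ → ℂ, AnalyticOnNhd ℂ H (Metric.ball 0 ρ) ∧ H 0 ≠ 0 ∧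
              ((∃ n : ℕ, n < r ∧ δ = n) →
                ∃ G : ℂ → ℂ, AnalyticOnNhd ℂ G (Metric.ball 0 ρ) ∧
                  ∀ z : slitDisc ζ θ ρ, (b l : slitDisc ζ θ ρ → ℂ) z =
                    powBranch θ (z - ζ) (r - 1 - δ) * H (z - ζ) * logBranch θ (z - ζ) +
                      ((z : ℂ) - ζ) ^ (r - 1) * G (z - ζ)) ∧
              ((∃ n : ℕ, r ≤ n ∧ δ = n) →
                ∃ k ∈ ({0, 1} : Set ℕ), ∃ H₀ : ℂ → ℂ,
                  AnalyticOnNhd ℂ H₀ (Metric.ball 0 ρ) ∧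
                  IsAnalyticSolutionOn r a (slitDisc ζ θ ρ) (fun z => H₀ (z - ζ)) ∧
                  ∀ z : slitDisc ζ θ ρ, (b l : slitDisc ζ θ ρ → ℂ) z =
                    powBranch θ (z - ζ) (r - 1 - δ) * H (z - ζ) +
                      H₀ (z - ζ) * logBranch θ (z - ζ) ^ k) ∧
              ((¬ ∃ n : ℤ, δ = n) →
                ∀ z : slitDisc ζ θ ρ, (b l : slitDisc ζ θ ρ → ℂ) z =
                  powBranch θ (z - ζ) (r - 1 - δ) * H (z - ζ)))

  := by
  obtain ⟨s, rfl⟩ : ∃ s, r = s + 1 := ⟨r - 1, by omega⟩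
  obtain ⟨c, M, K, hK, hcb, hc0, hcv, hc1, hδne, hev⟩ :=
    exists_equation_coefficients hr (fun i hi => ha i hi ζ hζ) hpole hδ
  -- The limit is nonzero because a_1 has a pole of order exactly 1, so δ = 0 does not occur.
  have hδpos : 0 < δ := lt_of_le_of_ne hδ0 fun h => hδne (by rw [← h]; simp)
  have hc00 : c 0 0 = 1 := by simp [hc0]
  obtain ⟨h, p, ρ₁, hρ₁, hh, hp, hF, hcases⟩ := exists_last_pair hK hcb hc00 hcv hδpos hc1
  choose! g ρ₂ hρ₂ hg hg0 hgF using fun m (hm : m < s) =>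
    exists_regular_pair hK hcb hc00 hcv hδpos hc1 hm
  obtain ⟨ρ₃, hρ₃, hle⟩ := exists_pos_le_forall_lt s hρ₂
  obtain ⟨ρ₄, hρ₄, hball⟩ := Metric.isOpen_iff.mp hΩ ζ hζ
  obtain ⟨ρ₅, hρ₅, heq⟩ := Metric.eventually_nhds_iff.mp (eventually_nhdsWithin_iff.mp hev)
  -- The recursions involve neither the slit nor ρ, so one R serves all of them.
  set R := min (min (min ρ₁ ρ₃) (min ρ₄ ρ₅)) K⁻¹ with hR
  have hR1 : R ≤ ρ₁ := (min_le_left _ _).trans ((min_le_left _ _).trans (min_le_left _ _))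
  have hR3 : R ≤ ρ₃ := (min_le_left _ _).trans ((min_le_left _ _).trans (min_le_right _ _))
  have hR4 : R ≤ ρ₄ := (min_le_left _ _).trans ((min_le_right _ _).trans (min_le_left _ _))
  have hR5 : R ≤ ρ₅ := (min_le_left _ _).trans ((min_le_right _ _).trans (min_le_right _ _))
  have hRK : R ≤ K⁻¹ := min_le_right _ _
  refine ⟨R, by positivity, (Metric.ball_subset_ball hR4).trans hball, fun θ ρ hρ hρR => ?_⟩
  have hcρ : ∀ i ∈ Finset.range (s + 1 + 1), ConvBound ρ (c i) := fun i hi =>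
    (convBound_of_geometric hK (hcb i hi)).mono (hρR.trans hRK)
  have haρ : ∀ i ∈ Finset.Icc 1 (s + 1), ∀ z ≠ ζ, ‖z - ζ‖ < ρ →
      (z - ζ) ^ i * a i z = seriesSum (c i) (z - ζ) := fun i hi z hz hzρ =>
    heq (by rw [dist_eq_norm]; exact hzρ.trans_le (hρR.trans hR5)) hz i hi
  replace hh := hh.mono (hρR.trans hR1)
  replace hp := hp.mono (hρR.trans hR1)
  have hgρ : ∀ m < s, ConvBound ρ (g m) := fun m hm =>
    (hg m hm).mono ((hρR.trans hR3).trans (hle m hm))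
  obtain ⟨b, hb1, hb2⟩ := exists_frobenius_basis (θ := θ) hρ hcρ hc0 haρ
    (fun m hm => ⟨hgρ m hm, hg0 m hm, hgF m hm⟩) hh hp hF hcases
  have hexp : ((s + 1 : ℕ) : ℂ) - 1 - δ = (s : ℂ) - δ := by push_cast; ring
  refine ⟨b, fun m hm => ?_, fun l hl => ?_⟩
  · have hm : (m : ℕ) < s := by omega
    refine ⟨seriesSum (g m), (hgρ m hm).analyticOnNhd, ?_, fun z => ?_⟩
    · rw [seriesSum_zero, hg0 m hm]
      exact one_ne_zero
    · rw [hb1 m hm z, frobFun_log_free, powBranch_natCast θ (sub_ne_zero_of_mem_slitDisc z.2)]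
  · obtain rfl : l = Fin.last s := Fin.ext (by simpa using hl)
    rw [hexp]
    rcases hcases with ⟨n, hns, hn, hδn, p0, hz⟩ | ⟨n, hns, hδn, h0, hpz⟩ | ⟨hint, h0, hp0⟩
    · have hδn' : (δ : ℂ) = n := by rw [hδn]; simp
      refine ⟨seriesSum p, hp.analyticOnNhd, by rw [seriesSum_zero, p0]; exact one_ne_zero,
        fun _ => ⟨seriesSum fun k => h (k + n), (hh.shift n).analyticOnNhd, fun z => ?_⟩,
        fun ⟨n', hn', hδn'⟩ => ?_, fun hint => absurd ⟨(n : ℤ), by simpa using hδn⟩ hint⟩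
      · rw [hb2 z, frobFun, hh.seriesSum_eq_shift n hz (norm_sub_lt_of_mem_slitDisc z.2), hδn',
          Nat.add_sub_cancel,
          ← powBranch_sub_natCast_mul_pow θ (sub_ne_zero_of_mem_slitDisc z.2) s n]
        ring
      · rw [hδn] at hδn'
        have : n = n' := by exact_mod_cast hδn'
        omega
    · have hδn' : (δ : ℂ) = n := by rw [hδn]; simp
      -- The series p starts at index n - s or later, which cancels the negative power w^(s-n) and
      -- leaves the analytic factor of the logarithm.
      have hH : ∀ z ∈ slitDisc ζ θ ρ, powBranch θ (z - ζ) ((s : ℂ) - δ) * seriesSum p (z - ζ) =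
          seriesSum (fun k => p (k + (n - s))) (z - ζ) := fun z hz => by
        rw [hp.seriesSum_eq_shift (n - s) (fun k hk => hpz k (by omega))
          (norm_sub_lt_of_mem_slitDisc hz), hδn', ← mul_assoc,
          powBranch_sub_natCast_mul_pow_sub θ (sub_ne_zero_of_mem_slitDisc hz) hns.le, one_mul]
      -- The power k = 1 always serves: a solution without logarithm corresponds to a vanishing
      -- factor.
      refine ⟨seriesSum h, hh.analyticOnNhd, by rw [seriesSum_zero, h0]; exact one_ne_zero,
        fun ⟨n', hn', hδn'⟩ => ?_, fun _ => ⟨1, by simp, seriesSum fun k => p (k + (n - s)),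
          (hp.shift _).analyticOnNhd, ?_, fun z => ?_⟩,
        fun hint => absurd ⟨(n : ℤ), by simpa using hδn⟩ hint⟩
      · rw [hδn] at hδn'
        have : n = n' := by exact_mod_cast hδn'
        omega
      -- The first system for p is exactly the log-free system at the same exponent, so the factor
      -- of the logarithm is itself a solution.
      · refine ((IsFrobeniusPair.of_log_free hF.1).isAnalyticSolutionOn hcρ hc0 haρ hp
          (convBound_zero ρ)).congr (isOpen_slitDisc ζ θ ρ) fun z hz => ?_
        rw [frobFun_log_free, hH z hz]
      · rw [hb2 z, frobFun, mul_add, mul_left_comm, hH z z.2, pow_one, mul_comm (logBranch _ _)]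
    · refine ⟨seriesSum h, hh.analyticOnNhd, by rw [seriesSum_zero, h0]; exact one_ne_zero,
        fun ⟨n, _, hδn⟩ => absurd ⟨(n : ℤ), by simpa using hδn⟩ hint,
        fun ⟨n, _, hδn⟩ => absurd ⟨(n : ℤ), by simpa using hδn⟩ hint, fun _ z => ?_⟩
      rw [hb2 z, hp0, frobFun_log_free]
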